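/- **Setting.** Let $\beta>0$, $z>0$, and let $\mathcal E:\mathbb R^d\to\mathbb R$ be a measurable even one-particle energy (for instance $\mathcal E(p)=|p|^2$ or $\mathcal E(p)=\sqrt{|p|^2+m^2}$, $m\ge 0$) in the noncritical regime $\sup_p z e^{-\beta\mathcal E(p)}<1$. Let $K_\beta=\mathbb R/\beta\mathbb Z$ and let $\mu_0$ be the free thermal field: the law of a (jointly measurable) centred real Gaussian process $\langle\phi,\delta_\tau\otimes f\rangle$, indexed by $\tau\in K_\beta$ and real $f\in L^2(\mathbb R^d)$, with covariance $$\mathbb E\,\langle\phi,\delta_\tau\otimes f\rangle\langle\phi,\delta_{\tau'}\otimes g\rangle=\int \hat S(|\tau-\tau'|,p)\,\overline{\hat f(p)}\,\hat g(p)\,dp,\qquad \hat S(s,p)=\frac{z^{s/\beta}e^{-s\mathcal E(p)}+z^{1-s/\beta}e^{-(\beta-s)\mathcal E(p)}}{1-ze^{-\beta\mathcal E(p)}}\quad(0\le s\le\beta),$$ with $|\tau-\tau'|$ the distance on $K_\beta$ and the unitary Fourier transform. For $g\in L^2(K_\beta)$ and $f\in L^2(\mathbb R^d)$ real put $\phi(g\otimes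 f)=\int_{K_\beta}g(\tau)\langle\phi,\delta_\tau\otimes f\rangle\,d\tau$. Let $0\le\chi_\epsilon\in C_c^\infty(\mathbb R^d)$ be supported in the ball of radius $\epsilon$ about $0$ with $\int\chi_\epsilon=1$, let $\phi_\epsilon(\tau,x)=\langle\phi,\delta_\tau\otimes\chi_\epsilon(x-\cdot)\rangle$, let $S_\epsilon(0)$ be its variance, and put $$:e^{i\alpha\phi_\epsilon}:(\tau,x)=e^{\frac{\alpha^2}{2}S_\epsilon(0)}e^{i\alpha\phi_\epsilon(\tau,x)},\qquad :\cos\alpha\phi_\epsilon:(\tau,x)=e^{\frac{\alpha^2}{2}S_\epsilon(0)}\cos\alpha\phi_\epsilon(\tau,x).$$ Let $\lambda>0$, let $\rho$ be an even, finite, nonnegative Borel measure on $\mathbb R$ with compact support, and for bounded measurable $\Lambda\subset\mathbb R^d$ let $W_\Lambda$ be either the local perturbation $$W_\Lambda=\lambda\int d\rho(\alpha)\int_0^\beta d\tau\int_\Lambda dx\,:e^{i\alpha\phi_\epsilon}:(\tau,x)$$ or the nonlocal perturbation $$W_\Lambda=\lambda\int_0^\beta d\tau\int d\rho(\alpha)\,d\rho(\alpha')\int_\Lambda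 dx\int_\Lambda dy\,:e^{i\alpha\phi_\epsilon}:(\tau,x)\,V(x-y)\,:e^{i\alpha'\phi_\epsilon}:(\tau,y),$$ where $0\le V\in L^1(\mathbb R^d)$. Put $Z_\Lambda=\int e^{W_\Lambda}d\mu_0$ and $d\mu_\Lambda=Z_\Lambda^{-1}e^{W_\Lambda}d\mu_0$, write $\langle\cdot\rangle_\Lambda$ for the expectation with respect to $\mu_\Lambda$, and $\langle A;B\rangle^T_\Lambda=\langle AB\rangle_\Lambda-\langle A\rangle_\Lambda\langle B\rangle_\Lambda$. **Proposition 3.8.** $W_\Lambda$ is real-valued, $e^{W_\Lambda}$ is $\mu_0$-integrable, $\mu_\Lambda$ is a probability measure, all expectations below exist, and the following correlation inequalities of Fröhlich–Park type hold. 1. $Z_{\Lambda_1\cup\Lambda_2}\ge Z_{\Lambda_1}Z_{\Lambda_2}$ for all bounded measurable $\Lambda_1,\Lambda_2$ whose intersection has Lebesgue measure zero. For every bounded measurable $\Lambda$, all real $g\in L^2(K_\beta)$, $f\in L^2(\mathbb R^d)$, all $n,m\ge 0$, all real $t,\alpha,\alpha_i,\gamma_j$ and all points $(\tau,x),(\tau_i,x_i),(s_i,x_i),(t_j,y_j)$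 of $K_\beta\times\mathbb R^d$: 2. $\langle\phi(g\otimes f)^2;\,:\cos\alpha\phi_\epsilon:(\tau,x)\rangle^T_\Lambda\le 0$; 3. $\langle e^{t\phi(g\otimes f)};\,\prod_{i=1}^n:\cos\alpha_i\phi_\epsilon:(\tau_i,x_i)\rangle^T_\Lambda\le 0$; 4. $\langle e^{i\phi(g\otimes f)};\,\prod_{i=1}^n:\cos\alpha_i\phi_\epsilon:(\tau_i,x_i)\rangle^T_\Lambda$ is real and $\ge 0$; 5. $\langle\prod_{i=1}^n\cos\alpha_i\phi_\epsilon(s_i,x_i);\,\prod_{j=1}^m\cos\gamma_j\phi_\epsilon(t_j,y_j)\rangle^T_\Lambda\ge 0$. -/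

import Mathlib

open MeasureTheory ProbabilityTheory
open scoped FourierTransform

namespace ThermalBose

/-- Configuration space `ℝ^d`. -/
abbrev Space (d : ℕ) : Type := EuclideanSpace ℝ (Fin d)

/-- Real `L²(ℝ^d)`, the space of spatial test functions of the field. -/
abbrev RealL2 (d : ℕ) : Type := Lp ℝ 2 (volume : Measure (Space d))

/-- For `β > 0`: the activity is positive, and `E` is an even measurable real one-particle energy in the noncritical
regime `sup_p z e^{-β E(p)} < 1`. -/
structure Noncritical {d : ℕ} (β z : ℝ) (E : Space d → ℝ) : Prop where
  z_pos : 0 < z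
  measurable : Measurable E
  even : ∀ p, E (-p) = E p
  sup_lt_one : ∃ q < 1, ∀ p, z * Real.exp (-β * E p) ≤ q

/-- The free thermal kernel in momentum space, for `0 ≤ s ≤ β`. -/
noncomputable def thermalKernelHat {d : ℕ} (β z : ℝ) (E : Space d → ℝ) (s : ℝ) (p : Space d) : ℝ :=
  (z ^ (s / β) * Real.exp (-s * E p) + z ^ (1 - s / β) * Real.exp (-(β - s) * E p)) /
    (1 - z * Real.exp (-β * E p))

/-- The `L²` Fourier transform of a real `L²` function (with `e^{-2πi⟨x,ξ⟩}`, so the momentum is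
`p = 2πξ`). -/
noncomputable def fourierReal {d : ℕ} (f : RealL2 d) : Lp ℂ 2 (volume : Measure (Space d)) :=
  𝓕 (Complex.ofRealCLM.compLp f)

/-- The free thermal covariance `S₀^β(s, f ⊗ g)`. The integral is real when `E` is even. -/
noncomputable def thermalCov {d : ℕ} (β z : ℝ) (E : Space d → ℝ) (s : ℝ) (f g : RealL2 d) : ℝ :=
  (∫ ξ : Space d, (thermalKernelHat β z E s ((2 * Real.pi) • ξ) : ℂ) *
    (starRingEnd ℂ (fourierReal f ξ) * fourierReal g ξ)).re

/-- `φ` realizes, on the probability space `(Ω, P)`, the free thermal field: the centred Gaussian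
process indexed by the circle `K_β = ℝ/βℤ` and by `L²(ℝ^d)`, with covariance the `β`-periodic
extension of `S₀^β` (note that `S₀^β(s) = S₀^β(β - s)` and that `‖τ - τ'‖` is the distance on the
circle), in a jointly measurable version. `φ τ f` is the random variable `⟨φ, δ_τ ⊗ f⟩`. -/
structure IsFreeThermalField {d : ℕ} (β z : ℝ) (E : Space d → ℝ) {Ω : Type*} [mΩ : MeasurableSpace Ω]
    (P : Measure Ω) (φ : AddCircle β → RealL2 d → Ω → ℝ) : Prop where
  gaussian : IsGaussianProcess (fun i : AddCircle β × RealL2 d => φ i.1 i.2) P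
  mean_zero : ∀ τ f, ∫ ω, φ τ f ω ∂P = 0
  covariance : ∀ τ τ' f g,
    ∫ ω, φ τ f ω * φ τ' g ω ∂P = thermalCov β z E ‖τ - τ'‖ f g
  measurable : Measurable[(borel (AddCircle β × RealL2 d)).prod mΩ]
    (fun q : (AddCircle β × RealL2 d) × Ω => φ q.1.1 q.1.2 q.2)

/-- A nonnegative smooth spatial mollifier at scale `ε`. -/
structure IsMollifier {d : ℕ} (ε : ℝ) (χ : Space d → ℝ) : Prop where
  smooth : ContDiff ℝ ((⊤ : ℕ∞) : WithTop ℕ∞) χ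
  compact : HasCompactSupport χ
  nonneg : ∀ x, 0 ≤ χ x
  support_subset : tsupport χ ⊆ Metric.ball 0 ε
  integral_eq_one : ∫ x, χ x = 1

theorem IsMollifier.memLp {d : ℕ} {ε : ℝ} {χ : Space d → ℝ} (h : IsMollifier ε χ) (x : Space d) :
    MemLp (fun y => χ (x - y)) 2 (volume : Measure (Space d)) := by
  have hc : Continuous fun y => χ (x - y) := h.smooth.continuous.comp (by fun_prop)
  refine hc.memLp_of_hasCompactSupport ?_
  exact h.compact.comp_homeomorph (Homeomorph.subLeft x)

/-- The test function `y ↦ χ (x - y)`. -/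
noncomputable def mollifierAt {d : ℕ} {ε : ℝ} {χ : Space d → ℝ} (h : IsMollifier ε χ)
    (x : Space d) : RealL2 d :=
  (h.memLp x).toLp _

section Field

variable {d : ℕ} {Ω : Type*} [MeasurableSpace Ω]

/-- The regularized field `φ_ε(τ, x) = (φ * χ_ε)(τ, x)`. -/
noncomputable def regField {β ε : ℝ} {χ : Space d → ℝ} (φ : AddCircle β → RealL2 d → Ω → ℝ)
    (hχ : IsMollifier ε χ) (τ : AddCircle β) (x : Space d) (ω : Ω) : ℝ :=
  φ τ (mollifierAt hχ x) ω

/-- The variance `S_ε^β(0, x)` of the regularized field at the spatial point `x`. -/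
noncomputable def regVar (β z : ℝ) (E : Space d → ℝ) {ε : ℝ} {χ : Space d → ℝ}
    (hχ : IsMollifier ε χ) (x : Space d) : ℝ :=
  thermalCov β z E 0 (mollifierAt hχ x) (mollifierAt hχ x)

/-- `:e^{iαφ_ε(τ,x)}:` -/
noncomputable def wickExp {β : ℝ} (z : ℝ) (E : Space d → ℝ) {ε : ℝ} {χ : Space d → ℝ}
    (φ : AddCircle β → RealL2 d → Ω → ℝ) (hχ : IsMollifier ε χ)
    (α : ℝ) (τ : AddCircle β) (x : Space d) (ω : Ω) : ℂ :=
  (Real.exp (α ^ 2 / 2 * regVar β z E hχ x) : ℂ) *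
    Complex.exp (Complex.I * α * regField φ hχ τ x ω)

/-- `:cos αφ_ε:(τ,x)` -/
noncomputable def wickCos {β : ℝ} (z : ℝ) (E : Space d → ℝ) {ε : ℝ} {χ : Space d → ℝ}
    (φ : AddCircle β → RealL2 d → Ω → ℝ) (hχ : IsMollifier ε χ)
    (α : ℝ) (τ : AddCircle β) (x : Space d) (ω : Ω) : ℝ :=
  Real.exp (α ^ 2 / 2 * regVar β z E hχ x) * Real.cos (α * regField φ hχ τ x ω)

/-- The local gentle perturbation `W_Λ`. -/
noncomputable def localPerturbation {β : ℝ} [Fact (0 < β)] (z : ℝ) (E : Space d → ℝ) {ε : ℝ}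
    {χ : Space d → ℝ} (φ : AddCircle β → RealL2 d → Ω → ℝ) (hχ : IsMollifier ε χ)
    (lam : ℝ) (ρ : Measure ℝ) (Λ : Set (Space d)) (ω : Ω) : ℂ :=
  (lam : ℂ) * ∫ α, ∫ τ : AddCircle β, ∫ x in Λ, wickExp z E φ hχ α τ x ω ∂volume ∂volume ∂ρ

/-- The nonlocal gentle perturbation `W_Λ` with two-body kernel `V`. -/
noncomputable def nonlocalPerturbation {β : ℝ} [Fact (0 < β)] (z : ℝ) (E : Space d → ℝ) {ε : ℝ}
    {χ : Space d → ℝ} (φ : AddCircle β → RealL2 d → Ω → ℝ) (hχ : IsMollifier ε χ)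
    (lam : ℝ) (ρ : Measure ℝ) (V : Space d → ℝ) (Λ : Set (Space d)) (ω : Ω) : ℂ :=
  (lam : ℂ) * ∫ τ : AddCircle β, ∫ α, ∫ α', ∫ x in Λ, ∫ y in Λ,
    wickExp z E φ hχ α τ x ω * (V (x - y) : ℂ) * wickExp z E φ hχ α' τ y ω
      ∂volume ∂volume ∂ρ ∂ρ ∂volume

/-- `W` is the family (indexed by the volume `Λ`) of an even gentle perturbation, either local or
nonlocal with a pointwise nonnegative integrable kernel. -/
def IsEvenGentle {β : ℝ} [Fact (0 < β)] (z : ℝ) (E : Space d → ℝ) {ε : ℝ}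
    {χ : Space d → ℝ} (φ : AddCircle β → RealL2 d → Ω → ℝ) (hχ : IsMollifier ε χ)
    (lam : ℝ) (ρ : Measure ℝ) (W : Set (Space d) → Ω → ℂ) : Prop :=
  W = localPerturbation z E φ hχ lam ρ ∨
    ∃ V : Space d → ℝ, Integrable V ∧ (∀ x, 0 ≤ V x) ∧
      W = nonlocalPerturbation z E φ hχ lam ρ V

/-- The smeared field `φ(g ⊗ f) = ∫_{K_β} g(τ) ⟨φ, δ_τ ⊗ f⟩ dτ`. -/
noncomputable def smeared {β : ℝ} [Fact (0 < β)] (φ : AddCircle β → RealL2 d → Ω → ℝ)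
    (g : AddCircle β → ℝ) (f : RealL2 d) (ω : Ω) : ℝ :=
  ∫ τ : AddCircle β, g τ * φ τ f ω

/-- The partition function `Z = ∫ e^W dP`, for a real-valued `W`. -/
noncomputable def partitionFunction (P : Measure Ω) (W : Ω → ℂ) : ℝ :=
  ∫ ω, Real.exp (W ω).re ∂P

/-- The perturbed measure `Z⁻¹ e^W dP`, for a real-valued `W`. -/
noncomputable def perturbedMeasure (P : Measure Ω) (W : Ω → ℂ) : Measure Ω :=
  P.tilted (fun ω => (W ω).re)

/-- The expectations entering `⟨A ; B⟩^T` exist. -/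
def TruncatedExists {𝕜 : Type*} [RCLike 𝕜] (μ : Measure Ω) (A B : Ω → 𝕜) : Prop :=
  Integrable A μ ∧ Integrable B μ ∧ Integrable (fun ω => A ω * B ω) μ

/-- The truncated correlation `⟨A ; B⟩^T = ⟨A B⟩ - ⟨A⟩⟨B⟩`. -/
noncomputable def truncated {𝕜 : Type*} [RCLike 𝕜] (μ : Measure Ω) (A B : Ω → 𝕜) : 𝕜 :=
  ∫ ω, A ω * B ω ∂μ - (∫ ω, A ω ∂μ) * ∫ ω, B ω ∂μ

end Field

end ThermalBose

open ThermalBose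

/-! The engine is Ginibre's duplication of variables. Because `ρ` is even, the interaction equals an
integral, with nonnegative weights, of cosines of variables in one Gaussian space `H`: of `α φ_ε(x)`
in the local case, of `α φ_ε(x) + α' φ_ε(y)` in the nonlocal one. For independent copies `Y₁, Y₂` of
`Y ∈ H`, `cos Y₁ ± cos Y₂` is twice `u((Y₁+Y₂)/2) u((Y₂-Y₁)/2)` with `u = cos` or `u = sin`.
Rotation by `π/4` preserves the doubled Gaussian law, so every finite product of such factors
integrates to a square (`integral_prod_pairFactor`).

Positivity is carried through `e^W` by duality. Multipliers of `dualCone` are stable under products,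
sums, nonnegative integrals and power series with nonnegative coefficients, so `e^{W(ω₁)+W(ω₂)}` is
one of them. Expanding a double integral then gives a correlation inequality
(`integral_mul_integral_le`) whenever `B(ω₁) - B(ω₂)` is a multiplier and `A(ω₁) - A(ω₂)` lies in
the cone. Multipliers are bounded, cone elements need not be; this admits `Y²` and `cosh Y`, whose
differences are pair factors of `id` and `sinh` with the opposite sign, hence the reversed
inequalities. The functions `e^Y` and `e^{iY}` reduce to `cosh Y` and `cos Y` by parity.

Supermultiplicativity is the same inequality for two exponentials, supplemented by `e^x ≥ 1 + x` for
the cross terms of the nonlocal interaction. Finally, `H` is taken to be the `L²`-closure of the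
span of the field variables: it stays Gaussian because characteristic functions are `L²`-continuous
(`isGaussianSpace_closure`), and it contains the time-smeared fields because a closed subspace is
its own double orthogonal complement (`integral_mul_mem_measurableLift`). -/

namespace ThermalBose

/-! ### Dual cones and the algebra of their multipliers. -/

section Cone

variable {S : Type*} [MeasurableSpace S]

/-- The cone of integrable functions having nonnegative integral against every function in `T`. -/
def dualCone (Q : Measure S) (T : Set (S → ℝ)) : Set (S → ℝ) :=
  {G | Integrable G Q ∧ ∀ M ∈ T, 0 ≤ ∫ s, M s * G s ∂Q}

/-- Bounded measurable functions whose multiplication preserves `dualCone Q T`. -/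
structure IsMultiplier (Q : Measure S) (T : Set (S → ℝ)) (h : S → ℝ) : Prop where
  measurable : Measurable h
  bounded : ∃ C, ∀ s, |h s| ≤ C
  mul_mem : ∀ G ∈ dualCone Q T, (fun s => h s * G s) ∈ dualCone Q T

variable {Q : Measure S} {T : Set (S → ℝ)}

theorem integrable_bounded_mul {h G : S → ℝ} (hm : Measurable h) (hb : ∃ C, ∀ s, |h s| ≤ C)
    (hG : Integrable G Q) : Integrable (fun s => h s * G s) Q := by
  obtain ⟨C, hC⟩ := hb
  exact hG.bdd_mul hm.aestronglyMeasurable (Filter.Eventually.of_forall hC)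

/-- Multiplication by `h` is self-adjoint for the pairing, so stability of the test set passes to
its dual cone. -/
theorem IsMultiplier.of_mul_mem {h : S → ℝ} (hm : Measurable h) (hb : ∃ C, ∀ s, |h s| ≤ C)
    (hT : ∀ M ∈ T, (fun s => M s * h s) ∈ T) : IsMultiplier Q T h := by
  refine ⟨hm, hb, fun G hG => ⟨integrable_bounded_mul hm hb hG.1, fun M hM => ?_⟩⟩
  have := hG.2 _ (hT M hM)
  simpa only [mul_assoc] using this

theorem IsMultiplier.mul {h k : S → ℝ} (hh : IsMultiplier Q T h) (hk : IsMultiplier Q T k) :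
    IsMultiplier Q T (fun s => h s * k s) := by
  obtain ⟨C, hC⟩ := hh.bounded
  obtain ⟨D, hD⟩ := hk.bounded
  refine ⟨hh.measurable.mul hk.measurable, ⟨C * D, fun s => ?_⟩, fun G hG => ?_⟩
  · rw [abs_mul]
    exact mul_le_mul (hC s) (hD s) (abs_nonneg _) ((abs_nonneg _).trans (hC s))
  · simpa only [mul_assoc] using hh.mul_mem _ (hk.mul_mem G hG)

theorem IsMultiplier.const {c : ℝ} (hc : 0 ≤ c) : IsMultiplier Q T (fun _ => c) := by
  refine ⟨measurable_const, ⟨|c|, fun _ => le_rfl⟩, fun G hG => ⟨hG.1.const_mul c, fun M hM => ?_⟩⟩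
  have : ∀ s, M s * (c * G s) = c * (M s * G s) := fun s => by ring
  simp only [this, integral_const_mul]
  exact mul_nonneg hc (hG.2 M hM)

theorem IsMultiplier.add (hT : ∀ M ∈ T, Measurable M ∧ ∃ C, ∀ s, |M s| ≤ C) {h k : S → ℝ}
    (hh : IsMultiplier Q T h) (hk : IsMultiplier Q T k) :
    IsMultiplier Q T (fun s => h s + k s) := by
  obtain ⟨C, hC⟩ := hh.bounded
  obtain ⟨D, hD⟩ := hk.bounded
  refine ⟨hh.measurable.add hk.measurable, ⟨C + D, fun s => (abs_add_le _ _).trans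
    (add_le_add (hC s) (hD s))⟩, fun G hG => ?_⟩
  have h1 := hh.mul_mem G hG
  have h2 := hk.mul_mem G hG
  simp only [add_mul]
  refine ⟨h1.1.add h2.1, fun M hM => ?_⟩
  simp only [mul_add]
  rw [integral_add (integrable_bounded_mul (hT M hM).1 (hT M hM).2 h1.1)
    (integrable_bounded_mul (hT M hM).1 (hT M hM).2 h2.1)]
  exact add_nonneg (h1.2 M hM) (h2.2 M hM)

theorem IsMultiplier.pow {h : S → ℝ} (hh : IsMultiplier Q T h) (n : ℕ) :
    IsMultiplier Q T (fun s => h s ^ n) := by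
  induction n with
  | zero => simpa using IsMultiplier.const zero_le_one
  | succ n ih => simpa only [pow_succ] using ih.mul hh

theorem measurable_integral_weight {Θ : Type*} [MeasurableSpace Θ] {ν : Measure Θ} [SFinite ν]
    {w : Θ → ℝ} (hw : AEStronglyMeasurable w ν) {h : Θ → S → ℝ}
    (hm : Measurable (fun q : Θ × S => h q.1 q.2)) :
    Measurable (fun s => ∫ θ, w θ * h θ s ∂ν) := by
  -- A measurable representative of the weight gives genuine, not merely almost everywhere,
  -- measurability in `s`.
  have : (fun s => ∫ θ, w θ * h θ s ∂ν) = fun s => ∫ θ, hw.mk w θ * h θ s ∂ν := by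
    ext s
    refine integral_congr_ae ?_
    filter_upwards [hw.ae_eq_mk] with θ hθ
    rw [hθ]
  rw [this]
  have h2 : StronglyMeasurable (fun q : Θ × S => hw.mk w q.1 * h q.1 q.2) :=
    ((hw.stronglyMeasurable_mk.measurable.comp measurable_fst).mul hm).stronglyMeasurable
  exact h2.integral_prod_left'.measurable

theorem abs_integral_weight_le {Θ : Type*} [MeasurableSpace Θ] {ν : Measure Θ}
    {w : Θ → ℝ} (hw : Integrable w ν) (hw0 : ∀ θ, 0 ≤ w θ) {h : Θ → ℝ} {C : ℝ}
    (hC : ∀ θ, |h θ| ≤ C) : |∫ θ, w θ * h θ ∂ν| ≤ C * ∫ θ, w θ ∂ν := by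
  rw [← integral_const_mul, ← Real.norm_eq_abs]
  refine norm_integral_le_of_norm_le (hw.const_mul C) (Filter.Eventually.of_forall fun θ => ?_)
  rw [Real.norm_eq_abs, abs_mul, abs_of_nonneg (hw0 θ), mul_comm]
  exact mul_le_mul_of_nonneg_right (hC θ) (hw0 θ)

/-- By Fubini the pairing with a test function is a `w`-weighted integral over `θ` of nonnegative
pairings. -/
theorem IsMultiplier.integral [SFinite Q] (hT : ∀ M ∈ T, Measurable M ∧ ∃ C, ∀ s, |M s| ≤ C)
    {Θ : Type*} [MeasurableSpace Θ] {ν : Measure Θ} [SFinite ν]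
    {w : Θ → ℝ} (hw : Integrable w ν) (hw0 : ∀ θ, 0 ≤ w θ) {h : Θ → S → ℝ}
    (hm : Measurable (fun q : Θ × S => h q.1 q.2)) {C : ℝ} (hC : ∀ θ s, |h θ s| ≤ C)
    (hh : ∀ θ, IsMultiplier Q T (h θ)) :
    IsMultiplier Q T (fun s => ∫ θ, w θ * h θ s ∂ν) := by
  have hmeas := measurable_integral_weight hw.aestronglyMeasurable hm
  have hbd : ∃ C', ∀ s, |∫ θ, w θ * h θ s ∂ν| ≤ C' :=
    ⟨_, fun s => abs_integral_weight_le hw hw0 fun θ => hC θ s⟩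
  refine ⟨hmeas, hbd, fun G hG => ⟨integrable_bounded_mul hmeas hbd hG.1, fun M hM => ?_⟩⟩
  have hMG := integrable_bounded_mul (hT M hM).1 (hT M hM).2 hG.1
  have hint : Integrable (Function.uncurry fun s θ => w θ * (M s * (h θ s * G s))) (Q.prod ν) := by
    have h1 : Integrable (fun q : S × Θ => h q.2 q.1 * ((M q.1 * G q.1) * w q.2)) (Q.prod ν) :=
      integrable_bounded_mul (h := fun q : S × Θ => h q.2 q.1) (hm.comp measurable_swap)
        ⟨C, fun q => hC _ _⟩ (hMG.mul_prod hw)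
    refine h1.congr (Filter.Eventually.of_forall fun q => ?_)
    simp only [Function.uncurry]
    ring
  have heq : ∫ s, M s * ((∫ θ, w θ * h θ s ∂ν) * G s) ∂Q
      = ∫ θ, w θ * ∫ s, M s * (h θ s * G s) ∂Q ∂ν := by
    simp only [← integral_const_mul]
    rw [← integral_integral_swap hint]
    refine integral_congr_ae (Filter.Eventually.of_forall fun s => ?_)
    simp only
    rw [← integral_mul_const, ← integral_const_mul]
    congr 1
    ext θ
    ring
  rw [heq]
  exact integral_nonneg fun θ => mul_nonneg (hw0 θ) (((hh θ).mul_mem G hG).2 M hM)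

/-- Each monomial with nonnegative coefficient is a multiplier, and the series converges dominatedly
because `h` is bounded. The exponents `e n` are free so that `sinh` is covered along with `exp`. -/
theorem IsMultiplier.comp_of_hasSum (hT : ∀ M ∈ T, Measurable M ∧ ∃ C, ∀ s, |M s| ≤ C)
    {c : ℕ → ℝ} {e : ℕ → ℕ} {f : ℝ → ℝ} (hc : ∀ n, 0 ≤ c n) (hf : Measurable f)
    (hs : ∀ x, HasSum (fun n => c n * x ^ e n) (f x)) {h : S → ℝ} (hh : IsMultiplier Q T h) :
    IsMultiplier Q T (fun s => f (h s)) := by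
  obtain ⟨C, hC⟩ := hh.bounded
  have hle : ∀ n s, |c n * h s ^ e n| ≤ c n * C ^ e n := fun n s => by
    rw [abs_mul, abs_of_nonneg (hc n), abs_pow]
    exact mul_le_mul_of_nonneg_left (pow_le_pow_left₀ (abs_nonneg _) (hC s) _) (hc n)
  have hmeas : Measurable fun s => f (h s) := hf.comp hh.measurable
  have hbd : ∃ C', ∀ s, |f (h s)| ≤ C' := by
    -- With nonnegative coefficients, the series at the bound `C` majorizes the series at `h s` term
    -- by term.
    refine ⟨f C, fun s => ?_⟩
    rw [← (hs (h s)).tsum_eq, ← (hs C).tsum_eq, ← Real.norm_eq_abs]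
    exact tsum_of_norm_bounded (hs C).summable.hasSum fun n => hle n s
  refine ⟨hmeas, hbd, fun G hG => ⟨integrable_bounded_mul hmeas hbd hG.1, fun M hM => ?_⟩⟩
  have hterm : ∀ n, IsMultiplier Q T fun s => c n * h s ^ e n := fun n =>
    (IsMultiplier.const (hc n)).mul (hh.pow (e n))
  have hMG := integrable_bounded_mul (hT M hM).1 (hT M hM).2 hG.1
  have hF : ∀ n, Integrable (fun s => c n * h s ^ e n * (M s * G s)) Q := fun n =>
    integrable_bounded_mul (hterm n).measurable (hterm n).bounded hMG
  have hsum : Summable fun n => ∫ s, ‖c n * h s ^ e n * (M s * G s)‖ ∂Q := by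
    refine Summable.of_nonneg_of_le (fun n => integral_nonneg fun s => norm_nonneg _) (fun n => ?_)
      ((hs C).summable.mul_right (∫ s, ‖M s * G s‖ ∂Q))
    rw [← integral_const_mul]
    refine integral_mono (hF n).norm (hMG.norm.const_mul _) fun s => ?_
    simp only [norm_mul (c n * h s ^ e n)]
    exact mul_le_mul_of_nonneg_right (hle n s) (norm_nonneg _)
  have hsol := hasSum_integral_of_summable_integral_norm hF hsum
  have heq : ∫ s, ∑' n, c n * h s ^ e n * (M s * G s) ∂Q = ∫ s, M s * (f (h s) * G s) ∂Q := by
    refine integral_congr_ae (Filter.Eventually.of_forall fun s => ?_)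
    simp only
    rw [tsum_mul_right, (hs (h s)).tsum_eq]
    ring
  rw [← heq]
  refine hsol.nonneg fun n => ?_
  have := ((hterm n).mul_mem G hG).2 M hM
  refine this.trans_eq (integral_congr_ae (Filter.Eventually.of_forall fun s => ?_))
  simp only
  ring

theorem IsMultiplier.exp (hT : ∀ M ∈ T, Measurable M ∧ ∃ C, ∀ s, |M s| ≤ C)
    {h : S → ℝ} (hh : IsMultiplier Q T h) : IsMultiplier Q T (fun s => Real.exp (h s)) := by
  refine hh.comp_of_hasSum hT (c := fun n => ((n.factorial : ℝ))⁻¹) (e := id)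
    (fun n => by positivity) Real.measurable_exp fun x => ?_
  have := NormedSpace.expSeries_div_hasSum_exp (𝔸 := ℝ) x
  rw [← Real.exp_eq_exp_ℝ] at this
  simpa [div_eq_inv_mul] using this

theorem IsMultiplier.sinh (hT : ∀ M ∈ T, Measurable M ∧ ∃ C, ∀ s, |M s| ≤ C)
    {h : S → ℝ} (hh : IsMultiplier Q T h) : IsMultiplier Q T (fun s => Real.sinh (h s)) := by
  refine hh.comp_of_hasSum hT (c := fun n => (((2 * n + 1).factorial : ℝ))⁻¹)
    (e := fun n => 2 * n + 1) (fun n => by positivity) Real.measurable_sinh fun x => ?_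
  simpa [div_eq_inv_mul] using Real.hasSum_sinh x

/-- Induction on `2(pp' + qq') = (p+q)(p'+q') + (p-q)(p'-q')` and `2(pp' - qq') = (p+q)(p'-q') +
(p-q)(p'+q')`; the two signs must be carried together. -/
theorem IsMultiplier.finset_prod_add_sub (hT : ∀ M ∈ T, Measurable M ∧ ∃ C, ∀ s, |M s| ≤ C)
    {ι : Type*} {p q : ι → S → ℝ} (hadd : ∀ i, IsMultiplier Q T fun s => p i s + q i s)
    (hsub : ∀ i, IsMultiplier Q T fun s => p i s - q i s) (A : Finset ι) :
    IsMultiplier Q T (fun s => ∏ i ∈ A, p i s + ∏ i ∈ A, q i s) ∧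
      IsMultiplier Q T (fun s => ∏ i ∈ A, p i s - ∏ i ∈ A, q i s) := by
  classical
  induction A using Finset.induction_on with
  | empty =>
    simp only [Finset.prod_empty, sub_self]
    exact ⟨IsMultiplier.const (by norm_num), IsMultiplier.const le_rfl⟩
  | insert a A ha ih =>
    have half : IsMultiplier Q T fun _ => (1 / 2 : ℝ) := IsMultiplier.const (by norm_num)
    simp only [Finset.prod_insert ha]
    constructor
    · convert half.mul (((hadd a).mul ih.1).add hT ((hsub a).mul ih.2)) using 2 with s
      ring
    · convert half.mul (((hadd a).mul ih.2).add hT ((hsub a).mul ih.1)) using 2 with s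
      ring

theorem IsMultiplier.finset_prod {ι : Type*} {p : ι → S → ℝ}
    (hp : ∀ i, IsMultiplier Q T (p i)) (A : Finset ι) :
    IsMultiplier Q T (fun s => ∏ i ∈ A, p i s) := by
  classical
  induction A using Finset.induction_on with
  | empty => simpa using IsMultiplier.const zero_le_one
  | insert a A ha ih => simpa only [Finset.prod_insert ha] using (hp a).mul ih

end Cone

/-! ### Gaussian spaces, rotation invariance and positivity of pair factors. -/

section GaussianSpace

variable {Ω : Type*} [MeasurableSpace Ω]

/-- A linear space of measurable centred Gaussian random variables. -/
structure IsGaussianSpace (P : Measure Ω) (H : Submodule ℝ (Ω → ℝ)) : Prop where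
  measurable : ∀ Y ∈ H, Measurable Y
  exists_law : ∀ Y ∈ H, ∃ v : NNReal, P.map Y = gaussianReal 0 v

variable {P : Measure Ω} {H : Submodule ℝ (Ω → ℝ)}

theorem IsGaussianSpace.isProbabilityMeasure (hH : IsGaussianSpace P H) :
    IsProbabilityMeasure P := by
  obtain ⟨v, hv⟩ := hH.exists_law 0 H.zero_mem
  have h : IsProbabilityMeasure (P.map (0 : Ω → ℝ)) := by rw [hv]; infer_instance
  exact Measure.isProbabilityMeasure_of_map (0 : Ω → ℝ)

theorem IsGaussianSpace.integral_eq_zero (hH : IsGaussianSpace P H) {Y : Ω → ℝ} (hY : Y ∈ H) :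
    ∫ ω, Y ω ∂P = 0 := by
  obtain ⟨v, hv⟩ := hH.exists_law Y hY
  have h := integral_map (μ := P) (hH.measurable Y hY).aemeasurable
    (f := fun x : ℝ => x) aestronglyMeasurable_id
  rw [← h, hv, integral_id_gaussianReal]

theorem IsGaussianSpace.memLp (hH : IsGaussianSpace P H) {Y : Ω → ℝ} (hY : Y ∈ H) :
    MemLp Y 2 P := by
  obtain ⟨v, hv⟩ := hH.exists_law Y hY
  have h : MemLp id 2 (P.map Y) := by rw [hv]; exact memLp_id_gaussianReal 2
  exact (memLp_map_measure_iff aestronglyMeasurable_id (hH.measurable Y hY).aemeasurable).1 h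

theorem IsGaussianSpace.integrable_exp (hH : IsGaussianSpace P H) {Y : Ω → ℝ} (hY : Y ∈ H) :
    Integrable (fun ω => Real.exp (Y ω)) P := by
  obtain ⟨v, hv⟩ := hH.exists_law Y hY
  have h : Integrable (fun x => Real.exp (1 * x)) (P.map Y) := by
    rw [hv]; exact integrable_exp_mul_gaussianReal 1
  simp only [one_mul] at h
  exact h.comp_measurable (hH.measurable Y hY)

/-- The integral is the characteristic function at `1`, namely `e^{-v/2}`. -/
theorem IsGaussianSpace.integral_cos_nonneg (hH : IsGaussianSpace P H) {Y : Ω → ℝ} (hY : Y ∈ H) :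
    0 ≤ ∫ ω, Real.cos (Y ω) ∂P := by
  obtain ⟨v, hv⟩ := hH.exists_law Y hY
  have := hH.isProbabilityMeasure
  have h := charFun_gaussianReal (μ := 0) (v := v) 1
  rw [← hv, charFun_apply_real, integral_map (hH.measurable Y hY).aemeasurable (by fun_prop)] at h
  have hint : Integrable (fun ω => Complex.exp (((1 : ℝ) : ℂ) * (Y ω : ℂ) * Complex.I)) P := by
    have hm := hH.measurable Y hY
    refine Integrable.of_bound (C := 1) (by fun_prop) (Filter.Eventually.of_forall fun ω => ?_)
    simp [Complex.norm_exp_ofReal_mul_I]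
  have h2 := congrArg Complex.re h
  rw [← RCLike.re_eq_complex_re, ← integral_re hint] at h2
  have h3 : ∀ ω, RCLike.re (Complex.exp (((1 : ℝ) : ℂ) * (Y ω : ℂ) * Complex.I))
      = Real.cos (Y ω) := fun ω => by
    simp [Complex.exp_ofReal_mul_I_re]
  simp only [h3] at h2
  rw [h2]
  have h4 : ((1 : ℝ) : ℂ) * ((0 : ℝ) : ℂ) * Complex.I - (v : ℂ) * ((1 : ℝ) : ℂ) ^ 2 / 2
      = ((-(v : ℝ) / 2 : ℝ) : ℂ) := by
    push_cast; simp; ring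
  rw [h4, RCLike.re_eq_complex_re, ← Complex.ofReal_exp, Complex.ofReal_re]
  positivity

/-- Any linear functional of the vector is again an element of `H`, so its law is a one-dimensional
Gaussian. -/
theorem IsGaussianSpace.isGaussian_map (hH : IsGaussianSpace P H) {ι : Type*} [Fintype ι]
    {Y : ι → Ω → ℝ} (hY : ∀ i, Y i ∈ H) : IsGaussian (P.map fun ω i => Y i ω) := by
  classical
  have hm : Measurable fun ω i => Y i ω := measurable_pi_lambda _ fun i => hH.measurable _ (hY i)
  refine isGaussian_of_map_eq_gaussianReal fun L => ?_
  rw [Measure.map_map (by fun_prop) hm]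
  have : (L ∘ fun ω i => Y i ω) = ∑ i, L (Pi.single i 1) • Y i := by
    ext ω
    simp only [Function.comp, Finset.sum_apply, Pi.smul_apply, smul_eq_mul]
    conv_lhs => rw [pi_eq_sum_univ' (fun i => Y i ω)]
    rw [map_sum]
    refine Finset.sum_congr rfl fun i _ => ?_
    rw [map_smul, smul_eq_mul, mul_comm]
  rw [this]
  obtain ⟨v, hv⟩ := hH.exists_law _ (H.sum_mem fun i _ => H.smul_mem _ (hY i))
  exact ⟨0, v, hv⟩

theorem IsGaussianSpace.map_rotation (hH : IsGaussianSpace P H) {ι : Type*} [Fintype ι]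
    {Y : ι → Ω → ℝ} (hY : ∀ i, Y i ∈ H) (θ : ℝ) :
    ((P.map fun ω i => Y i ω).prod (P.map fun ω i => Y i ω)).map
        (ContinuousLinearMap.rotation θ)
      = (P.map fun ω i => Y i ω).prod (P.map fun ω i => Y i ω) := by
  classical
  have := hH.isGaussian_map hY
  have hm : Measurable fun ω i => Y i ω := measurable_pi_lambda _ fun i => hH.measurable _ (hY i)
  refine IsGaussian.map_rotation_eq_self_of_forall_strongDual_eq_zero (fun L => ?_) θ
  rw [integral_map hm.aemeasurable (by fun_prop)]
  have : (fun ω => L fun i => Y i ω) = ∑ i, L (Pi.single i 1) • Y i := by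
    ext ω
    simp only [Finset.sum_apply, Pi.smul_apply, smul_eq_mul]
    conv_lhs => rw [pi_eq_sum_univ' (fun i => Y i ω)]
    rw [map_sum]
    refine Finset.sum_congr rfl fun i _ => ?_
    rw [map_smul, smul_eq_mul, mul_comm]
  rw [this]
  exact hH.integral_eq_zero (H.sum_mem fun i _ => H.smul_mem _ (hY i))

/-- The product of the values of `u` at the half sum and at the half difference of two copies. -/
noncomputable def pairFactor (u : ℝ → ℝ) (Y : Ω → ℝ) (q : Ω × Ω) : ℝ :=
  u ((Y q.1 + Y q.2) / 2) * u ((Y q.2 - Y q.1) / 2)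

theorem measurable_pairFactor {u : ℝ → ℝ} (hu : Measurable u) {Y : Ω → ℝ} (hY : Measurable Y) :
    Measurable (pairFactor u Y) := by
  unfold pairFactor
  fun_prop

/-- The half sum and half difference are the coordinates rotated by `π/4`, divided by `√2`. After
the rotation the two copies are independent again, and the integral factorizes into two equal ones.
No boundedness of `u` is imposed, which is what allows `id` and `sinh` later. -/
theorem IsGaussianSpace.integral_prod_pairFactor (hH : IsGaussianSpace P H) {ι : Type*} [Fintype ι]
    {Y : ι → Ω → ℝ} (hY : ∀ i, Y i ∈ H) {u : ι → ℝ → ℝ} (hu : ∀ i, Measurable (u i)) :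
    ∫ q, ∏ i, pairFactor (u i) (Y i) q ∂(P.prod P) = (∫ ω, ∏ i, u i (Y i ω / √2) ∂P) ^ 2 := by
  have := hH.isProbabilityMeasure
  have hm : Measurable fun ω i => Y i ω := measurable_pi_lambda _ fun i => hH.measurable _ (hY i)
  have hG : Measurable fun a : ι → ℝ => ∏ i, u i (a i / √2) :=
    Finset.measurable_prod _ fun i _ => (hu i).comp ((measurable_pi_apply i).div_const _)
  have hF : Measurable fun p : (ι → ℝ) × (ι → ℝ) =>
      (∏ i, u i (p.1 i / √2)) * ∏ i, u i (p.2 i / √2) :=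
    (hG.comp measurable_fst).mul (hG.comp measurable_snd)
  have hrot : Measurable (ContinuousLinearMap.rotation (E := ι → ℝ) (Real.pi / 4)) := by fun_prop
  have h1 : ∫ p, (∏ i, u i (p.1 i / √2)) * ∏ i, u i (p.2 i / √2)
      ∂((P.map fun ω i => Y i ω).prod (P.map fun ω i => Y i ω))
      = (∫ ω, ∏ i, u i (Y i ω / √2) ∂P) ^ 2 := by
    rw [integral_prod_mul (fun a : ι → ℝ => ∏ i, u i (a i / √2))
      (fun a : ι → ℝ => ∏ i, u i (a i / √2)),
      integral_map hm.aemeasurable hG.aestronglyMeasurable, sq]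
  rw [← h1, ← hH.map_rotation hY (Real.pi / 4),
    integral_map hrot.aemeasurable hF.aestronglyMeasurable, Measure.map_prod_map _ _ hm hm,
    integral_map (hm.prodMap hm).aemeasurable (by fun_prop)]
  refine integral_congr_ae (Filter.Eventually.of_forall fun q => ?_)
  have hs : √2 * √2 = 2 := Real.mul_self_sqrt (by norm_num)
  simp only [ContinuousLinearMap.rotation_apply, Prod.map, Real.cos_pi_div_four,
    Real.sin_pi_div_four, ← Finset.prod_mul_distrib, pairFactor]
  refine Finset.prod_congr rfl fun i _ => ?_
  have e1 : (Y i q.1 + Y i q.2) / 2 = ((√2 / 2) * Y i q.1 + (√2 / 2) * Y i q.2) / √2 := by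
    field_simp
  have e2 : (Y i q.2 - Y i q.1) / 2 = (-(√2 / 2) * Y i q.1 + (√2 / 2) * Y i q.2) / √2 := by
    field_simp; ring
  simp [e1, e2]

/-- Rotation by `π` negates both copies; its first marginal gives the symmetry of the joint law. -/
theorem IsGaussianSpace.integral_comp_neg (hH : IsGaussianSpace P H) {ι : Type*} [Fintype ι]
    {Y : ι → Ω → ℝ} (hY : ∀ i, Y i ∈ H) {f : (ι → ℝ) → ℝ} (hf : Measurable f) :
    ∫ ω, f (fun i => -Y i ω) ∂P = ∫ ω, f (fun i => Y i ω) ∂P := by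
  have := hH.isProbabilityMeasure
  have hm : Measurable fun ω i => Y i ω := measurable_pi_lambda _ fun i => hH.measurable _ (hY i)
  set μ := P.map fun ω i => Y i ω with hμ
  have : IsProbabilityMeasure μ := Measure.isProbabilityMeasure_map hm.aemeasurable
  have hrot : Measurable (ContinuousLinearMap.rotation (E := ι → ℝ) Real.pi) := by fun_prop
  have h1 : μ.map (fun a => -a) = μ := by
    have e1 : μ = (μ.prod μ).map Prod.fst := by simp
    conv_rhs => rw [e1, ← hH.map_rotation hY Real.pi, ← hμ, Measure.map_map measurable_fst hrot]
    conv_lhs => rw [e1, Measure.map_map measurable_neg measurable_fst]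
    congr 1
    ext p
    simp [ContinuousLinearMap.rotation_apply]
  have h2 : ∫ a, f (-a) ∂μ = ∫ a, f a ∂μ := by
    conv_rhs => rw [← h1]
    rw [integral_map measurable_neg.aemeasurable hf.aestronglyMeasurable]
  have hfn : Measurable fun a : ι → ℝ => f (-a) := hf.comp measurable_neg
  rw [hμ, integral_map hm.aemeasurable hfn.aestronglyMeasurable,
    integral_map hm.aemeasurable hf.aestronglyMeasurable] at h2
  exact h2

/-- Finite products of bounded pair factors over a Gaussian space. -/
def pairProducts (H : Submodule ℝ (Ω → ℝ)) : Set (Ω × Ω → ℝ) :=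
  {M | ∃ (n : ℕ) (u : Fin n → ℝ → ℝ) (Y : Fin n → Ω → ℝ), (∀ i, Measurable (u i)) ∧
    (∀ i, ∃ C, ∀ x, |u i x| ≤ C) ∧ (∀ i, Y i ∈ H) ∧
    M = fun q => ∏ i, pairFactor (u i) (Y i) q}

/-- Finite products of cosines over a Gaussian space. -/
def cosProducts (H : Submodule ℝ (Ω → ℝ)) : Set (Ω → ℝ) :=
  {M | ∃ (n : ℕ) (Y : Fin n → Ω → ℝ), (∀ i, Y i ∈ H) ∧ M = fun ω => ∏ i, Real.cos (Y i ω)}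

theorem exists_abs_pairFactor_le {S : Type*} {u : ℝ → ℝ} (hu : ∃ C, ∀ x, |u x| ≤ C) (Y : S → ℝ) :
    ∃ C, ∀ q, |pairFactor u Y q| ≤ C := by
  obtain ⟨C, hC⟩ := hu
  refine ⟨C * C, fun q => ?_⟩
  rw [pairFactor, abs_mul]
  exact mul_le_mul (hC _) (hC _) (abs_nonneg _) ((abs_nonneg _).trans (hC 0))

theorem exists_abs_prod_le {S ι : Type*} {f : ι → S → ℝ} (A : Finset ι)
    (hf : ∀ i, ∃ C, ∀ s, |f i s| ≤ C) : ∃ C, ∀ s, |∏ i ∈ A, f i s| ≤ C := by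
  choose C hC using hf
  refine ⟨∏ i ∈ A, C i, fun s => ?_⟩
  rw [Finset.abs_prod]
  exact Finset.prod_le_prod (fun i _ => abs_nonneg _) fun i _ => hC i s

theorem IsGaussianSpace.bounded_of_mem_pairProducts (hH : IsGaussianSpace P H) :
    ∀ M ∈ pairProducts H, Measurable M ∧ ∃ C, ∀ s, |M s| ≤ C := by
  rintro M ⟨n, u, Y, hu, hb, hY, rfl⟩
  exact ⟨Finset.measurable_prod _ fun i _ => measurable_pairFactor (hu i) (hH.measurable _ (hY i)),
    exists_abs_prod_le _ fun i => exists_abs_pairFactor_le (hb i) (Y i)⟩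

theorem IsGaussianSpace.bounded_of_mem_cosProducts (hH : IsGaussianSpace P H) :
    ∀ M ∈ cosProducts H, Measurable M ∧ ∃ C, ∀ s, |M s| ≤ C := by
  rintro M ⟨n, Y, hY, rfl⟩
  exact ⟨Finset.measurable_prod _ fun i _ => Real.measurable_cos.comp (hH.measurable _ (hY i)),
    exists_abs_prod_le _ fun i => ⟨1, fun ω => Real.abs_cos_le_one _⟩⟩

theorem IsGaussianSpace.isMultiplier_pairFactor (hH : IsGaussianSpace P H) {u : ℝ → ℝ}
    (hu : Measurable u) (hb : ∃ C, ∀ x, |u x| ≤ C) {Y : Ω → ℝ} (hY : Y ∈ H) :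
    IsMultiplier (P.prod P) (pairProducts H) (pairFactor u Y) := by
  refine .of_mul_mem (measurable_pairFactor hu (hH.measurable _ hY))
    (exists_abs_pairFactor_le hb Y) ?_
  rintro M ⟨n, v, Z, hv, hvb, hZ, rfl⟩
  refine ⟨n + 1, Fin.cons u v, Fin.cons Y Z, Fin.cases hu hv, Fin.cases hb hvb,
    Fin.cases hY hZ, ?_⟩
  ext q
  simp [Fin.prod_univ_succ, mul_comm]

theorem IsGaussianSpace.isMultiplier_cos (hH : IsGaussianSpace P H) {Y : Ω → ℝ} (hY : Y ∈ H) :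
    IsMultiplier P (cosProducts H) (fun ω => Real.cos (Y ω)) := by
  refine .of_mul_mem (Real.measurable_cos.comp (hH.measurable _ hY))
    ⟨1, fun ω => Real.abs_cos_le_one _⟩ ?_
  rintro M ⟨n, Z, hZ, rfl⟩
  refine ⟨n + 1, Fin.cons Y Z, Fin.cases hY hZ, ?_⟩
  ext q
  simp [Fin.prod_univ_succ, mul_comm]

/-- Against a test product, `u` is just one more pair factor, so the pairing is a square. Only
integrability is needed, not boundedness of `u`. -/
theorem IsGaussianSpace.pairFactor_mem_dualCone (hH : IsGaussianSpace P H) {u : ℝ → ℝ}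
    (hu : Measurable u) {Y : Ω → ℝ} (hY : Y ∈ H) (hi : Integrable (pairFactor u Y) (P.prod P)) :
    pairFactor u Y ∈ dualCone (P.prod P) (pairProducts H) := by
  refine ⟨hi, ?_⟩
  rintro M ⟨n, v, Z, hv, -, hZ, rfl⟩
  have h := hH.integral_prod_pairFactor (ι := Fin (n + 1)) (Y := Fin.cons Y Z)
    (Fin.cases hY hZ) (u := Fin.cons u v) (Fin.cases hu hv)
  simp only [Fin.prod_univ_succ, Fin.cons_zero, Fin.cons_succ] at h
  simp only [mul_comm _ (pairFactor u Y _)]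
  rw [h]
  positivity

theorem IsGaussianSpace.one_mem_dualCone (hH : IsGaussianSpace P H) :
    (fun _ => (1 : ℝ)) ∈ dualCone (P.prod P) (pairProducts H) := by
  have := hH.isProbabilityMeasure
  have h := hH.pairFactor_mem_dualCone (u := fun _ => 1) measurable_const H.zero_mem
    (by unfold pairFactor; simp)
  unfold pairFactor at h
  simpa using h

/-- Cosine products are even, so by symmetry of the law every pairing vanishes. The same applies to
`-s`, and this two-sided membership is exploited in `integral_odd_mul_eq_zero`. -/
theorem IsGaussianSpace.odd_mem_dualCone (hH : IsGaussianSpace P H) {s : ℝ → ℝ}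
    (hs : Measurable s) (hodd : ∀ x, s (-x) = -s x) {Y : Ω → ℝ} (hY : Y ∈ H)
    (hi : Integrable (fun ω => s (Y ω)) P) :
    (fun ω => s (Y ω)) ∈ dualCone P (cosProducts H) := by
  refine ⟨hi, ?_⟩
  rintro M ⟨n, Z, hZ, rfl⟩
  have h := hH.integral_comp_neg (ι := Fin (n + 1)) (Y := Fin.cons Y Z)
    (Fin.cases hY hZ) (f := fun a => (∏ i : Fin n, Real.cos (a i.succ)) * s (a 0)) (by fun_prop)
  simp only [Fin.cons_zero, Fin.cons_succ, Real.cos_neg, hodd, mul_neg, integral_neg] at h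
  linarith

theorem IsGaussianSpace.isMultiplier_cos_add (hH : IsGaussianSpace P H) {Y : Ω → ℝ} (hY : Y ∈ H) :
    IsMultiplier (P.prod P) (pairProducts H) (fun q => Real.cos (Y q.1) + Real.cos (Y q.2)) := by
  have h := hH.isMultiplier_pairFactor Real.measurable_cos ⟨1, Real.abs_cos_le_one⟩ hY
  convert (IsMultiplier.const zero_le_two).mul h using 2 with q
  rw [pairFactor, Real.cos_add_cos, ← Real.cos_neg ((Y q.1 - Y q.2) / 2)]
  ring_nf

theorem IsGaussianSpace.isMultiplier_cos_sub (hH : IsGaussianSpace P H) {Y : Ω → ℝ} (hY : Y ∈ H) :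
    IsMultiplier (P.prod P) (pairProducts H) (fun q => Real.cos (Y q.1) - Real.cos (Y q.2)) := by
  have h := hH.isMultiplier_pairFactor Real.measurable_sin ⟨1, Real.abs_sin_le_one⟩ hY
  convert (IsMultiplier.const zero_le_two).mul h using 2 with q
  -- The half difference is oriented as second minus first, which absorbs the minus sign of the
  -- sum-to-product formula.
  have h2 : (Y q.2 - Y q.1) / 2 = -((Y q.1 - Y q.2) / 2) := by ring
  rw [pairFactor, Real.cos_sub_cos, h2, Real.sin_neg]
  ring

end GaussianSpace

/-! ### Ginibre's inequality and truncated correlations in the tilted measure. -/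

section Ginibre

variable {Ω : Type*} [MeasurableSpace Ω]

/-- Bounded functions which generate Ginibre-type inequalities over the Gaussian space `H`: sums and
differences of two independent copies are multipliers of the cone dual to `pairProducts H`. -/
structure IsGinibre (P : Measure Ω) (H : Submodule ℝ (Ω → ℝ)) (W : Ω → ℝ) : Prop where
  measurable : Measurable W
  bounded : ∃ C, ∀ ω, |W ω| ≤ C
  add : IsMultiplier (P.prod P) (pairProducts H) fun q => W q.1 + W q.2
  sub : IsMultiplier (P.prod P) (pairProducts H) fun q => W q.1 - W q.2
  single : IsMultiplier P (cosProducts H) W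

variable {P : Measure Ω} {H : Submodule ℝ (Ω → ℝ)}

theorem IsGaussianSpace.isGinibre_cos (hH : IsGaussianSpace P H) {Y : Ω → ℝ} (hY : Y ∈ H) :
    IsGinibre P H (fun ω => Real.cos (Y ω)) :=
  ⟨Real.measurable_cos.comp (hH.measurable _ hY), ⟨1, fun _ => Real.abs_cos_le_one _⟩,
    hH.isMultiplier_cos_add hY, hH.isMultiplier_cos_sub hY, hH.isMultiplier_cos hY⟩

theorem IsGinibre.const_mul {W : Ω → ℝ} (hW : IsGinibre P H W) {c : ℝ} (hc : 0 ≤ c) :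
    IsGinibre P H (fun ω => c * W ω) := by
  have h := (IsMultiplier.const (Q := P) (T := cosProducts H) hc).mul hW.single
  refine ⟨h.measurable, h.bounded, ?_, ?_, h⟩
  · simpa only [mul_add] using (IsMultiplier.const hc).mul hW.add
  · simpa only [mul_sub] using (IsMultiplier.const hc).mul hW.sub

theorem IsGaussianSpace.isGinibre_prod (hH : IsGaussianSpace P H) {ι : Type*} (A : Finset ι)
    {W : ι → Ω → ℝ} (hW : ∀ i, IsGinibre P H (W i)) : IsGinibre P H (fun ω => ∏ i ∈ A, W i ω) := by
  have h := IsMultiplier.finset_prod (fun i => (hW i).single) A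
  have h2 := IsMultiplier.finset_prod_add_sub hH.bounded_of_mem_pairProducts
    (p := fun i q => W i q.1) (q := fun i q => W i q.2) (fun i => (hW i).add)
    (fun i => (hW i).sub) A
  exact ⟨h.measurable, h.bounded, h2.1, h2.2, h⟩

/-- This is how the interaction itself enters: sums and differences of two copies are taken under
the integral, where each cosine is already a multiplier. -/
theorem IsGaussianSpace.isGinibre_integral (hH : IsGaussianSpace P H)
    {Θ : Type*} [MeasurableSpace Θ] {ν : Measure Θ} [SFinite ν]
    {w : Θ → ℝ} (hw : Integrable w ν) (hw0 : ∀ θ, 0 ≤ w θ) {X : Θ → Ω → ℝ}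
    (hm : Measurable (fun q : Θ × Ω => X q.1 q.2)) (hX : ∀ θ, X θ ∈ H) :
    IsGinibre P H (fun ω => ∫ θ, w θ * Real.cos (X θ ω) ∂ν) := by
  have := hH.isProbabilityMeasure
  have hcos : Measurable (fun q : Θ × Ω => Real.cos (X q.1 q.2)) := Real.measurable_cos.comp hm
  have h1 : Measurable (fun q : Θ × (Ω × Ω) => Real.cos (X q.1 q.2.1)) :=
    hcos.comp (f := fun q : Θ × (Ω × Ω) => (q.1, q.2.1))
      (measurable_fst.prodMk (measurable_fst.comp measurable_snd))
  have h2 : Measurable (fun q : Θ × (Ω × Ω) => Real.cos (X q.1 q.2.2)) :=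
    hcos.comp (f := fun q : Θ × (Ω × Ω) => (q.1, q.2.2))
      (measurable_fst.prodMk (measurable_snd.comp measurable_snd))
  have hint : ∀ ω, Integrable (fun θ => w θ * Real.cos (X θ ω)) ν := fun ω => by
    have := integrable_bounded_mul (h := fun θ => Real.cos (X θ ω))
      (hcos.comp (f := fun θ : Θ => (θ, ω)) measurable_prodMk_right) ⟨1, fun _ => Real.abs_cos_le_one _⟩ hw
    simpa only [mul_comm] using this
  have hs := IsMultiplier.integral (C := 1) (h := fun θ ω => Real.cos (X θ ω))
    hH.bounded_of_mem_cosProducts hw hw0 hcos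
    (fun θ ω => Real.abs_cos_le_one _) fun θ => hH.isMultiplier_cos (hX θ)
  refine ⟨hs.measurable, hs.bounded, ?_, ?_, hs⟩
  · have h := IsMultiplier.integral (C := 2) (ν := ν) (w := w)
      (h := fun θ (q : Ω × Ω) => Real.cos (X θ q.1) + Real.cos (X θ q.2))
      hH.bounded_of_mem_pairProducts hw hw0 (h1.add h2)
      (fun θ q => (abs_add_le _ _).trans
        (by linarith [Real.abs_cos_le_one (X θ q.1), Real.abs_cos_le_one (X θ q.2)]))
      fun θ => hH.isMultiplier_cos_add (hX θ)
    have he : (fun q : Ω × Ω => ∫ θ, w θ * (Real.cos (X θ q.1) + Real.cos (X θ q.2)) ∂ν)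
        = fun q => ∫ θ, w θ * Real.cos (X θ q.1) ∂ν + ∫ θ, w θ * Real.cos (X θ q.2) ∂ν := by
      ext q
      simp only [mul_add]
      exact integral_add (hint q.1) (hint q.2)
    rwa [he] at h
  · have h := IsMultiplier.integral (C := 2) (ν := ν) (w := w)
      (h := fun θ (q : Ω × Ω) => Real.cos (X θ q.1) - Real.cos (X θ q.2))
      hH.bounded_of_mem_pairProducts hw hw0 (h1.sub h2)
      (fun θ q => (abs_sub _ _).trans
        (by linarith [Real.abs_cos_le_one (X θ q.1), Real.abs_cos_le_one (X θ q.2)]))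
      fun θ => hH.isMultiplier_cos_sub (hX θ)
    have he : (fun q : Ω × Ω => ∫ θ, w θ * (Real.cos (X θ q.1) - Real.cos (X θ q.2)) ∂ν)
        = fun q => ∫ θ, w θ * Real.cos (X θ q.1) ∂ν - ∫ θ, w θ * Real.cos (X θ q.2) ∂ν := by
      ext q
      simp only [mul_sub]
      exact integral_sub (hint q.1) (hint q.2)
    rwa [he] at h

theorem IsGinibre.exists_exp_le {W : Ω → ℝ} (hW : IsGinibre P H W) :
    ∃ C, ∀ ω, |Real.exp (W ω)| ≤ C := by
  obtain ⟨C, hC⟩ := hW.bounded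
  exact ⟨Real.exp C, fun ω => by
    rw [abs_of_pos (Real.exp_pos _)]; exact Real.exp_le_exp.2 (abs_le.1 (hC ω)).2⟩

theorem IsGinibre.integrable_exp [IsFiniteMeasure P] {W : Ω → ℝ} (hW : IsGinibre P H W) :
    Integrable (fun ω => Real.exp (W ω)) P := by
  simpa using integrable_bounded_mul hW.measurable.exp hW.exists_exp_le
    (integrable_const (μ := P) (1 : ℝ))

theorem integrable_exp_smul {𝕜 : Type*} [RCLike 𝕜] {W : Ω → ℝ} (hW : IsGinibre P H W)
    {g : Ω → 𝕜} (hg : Integrable g P) : Integrable (fun ω => Real.exp (W ω) • g ω) P := by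
  obtain ⟨C, hC⟩ := hW.exists_exp_le
  exact hg.bdd_smul C hW.measurable.exp.aestronglyMeasurable (Filter.Eventually.of_forall hC)

theorem IsGinibre.truncatedExists [IsFiniteMeasure P] {𝕜 : Type*} [RCLike 𝕜] {W : Ω → ℝ}
    (hW : IsGinibre P H W) {A B : Ω → 𝕜} (hA : Integrable A P) (hB : Measurable B)
    (hb : ∃ C, ∀ ω, ‖B ω‖ ≤ C) : TruncatedExists (P.tilted W) A B := by
  obtain ⟨C, hC⟩ := hb
  refine ⟨?_, ?_, ?_⟩ <;> rw [integrable_tilted_iff hW.integrable_exp] <;>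
    refine integrable_exp_smul hW ?_
  · exact hA
  · exact Integrable.of_bound hB.aestronglyMeasurable C (Filter.Eventually.of_forall hC)
  · exact hA.mul_bdd hB.aestronglyMeasurable (Filter.Eventually.of_forall hC)

/-- Ginibre's inequality by duplication of variables. -/
theorem IsGaussianSpace.integral_mul_integral_le (hH : IsGaussianSpace P H) {F A B : Ω → ℝ}
    (hF : Measurable F) (hFb : ∃ C, ∀ ω, |F ω| ≤ C)
    (hFF : IsMultiplier (P.prod P) (pairProducts H) fun q => F q.1 * F q.2)
    (hB : Measurable B) (hBb : ∃ C, ∀ ω, |B ω| ≤ C)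
    (hBB : IsMultiplier (P.prod P) (pairProducts H) fun q => B q.1 - B q.2)
    (hA : Integrable A P)
    (hAA : (fun q : Ω × Ω => A q.1 - A q.2) ∈ dualCone (P.prod P) (pairProducts H)) :
    (∫ ω, F ω * A ω ∂P) * ∫ ω, F ω * B ω ∂P ≤ (∫ ω, F ω ∂P) * ∫ ω, F ω * (A ω * B ω) ∂P := by
  have := hH.isProbabilityMeasure
  -- The test function `1` is the empty product of pair factors. Expanding the integrand gives twice
  -- the difference of the two sides of the claim.
  have h0 := ((hFF.mul hBB).mul_mem _ hAA).2 (fun _ => 1)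
    ⟨0, fun _ _ => 0, fun _ => 0, fun i => i.elim0, fun i => i.elim0, fun i => i.elim0, by simp⟩
  have iF : Integrable F P := by
    simpa using integrable_bounded_mul hF hFb (integrable_const (μ := P) (1 : ℝ))
  have iB : Integrable B P := by
    simpa using integrable_bounded_mul hB hBb (integrable_const (μ := P) (1 : ℝ))
  have iFA := integrable_bounded_mul hF hFb hA
  have iFB := integrable_bounded_mul hF hFb iB
  have iFAB := integrable_bounded_mul hF hFb (integrable_bounded_mul hB hBb hA)
  have key : ∫ q : Ω × Ω, 1 * (F q.1 * F q.2 * (B q.1 - B q.2) * (A q.1 - A q.2)) ∂(P.prod P)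
      = ∫ q : Ω × Ω, ((F q.1 * (B q.1 * A q.1)) * F q.2 + F q.1 * (F q.2 * (B q.2 * A q.2)))
        - ((F q.1 * A q.1) * (F q.2 * B q.2) + (F q.1 * B q.1) * (F q.2 * A q.2)) ∂(P.prod P) :=
    integral_congr_ae (Filter.Eventually.of_forall fun q => by simp only; ring)
  have i1 := iFAB.mul_prod iF
  have i2 := iF.mul_prod iFAB
  have i3 := iFA.mul_prod iFB
  have i4 := iFB.mul_prod iFA
  have k1 := integral_sub (i1.add i2) (i3.add i4)
  have k2 := integral_add i1 i2
  have k3 := integral_add i3 i4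
  simp only [Pi.add_apply] at k1
  rw [key, k1, k2, k3,
    integral_prod_mul (fun ω => F ω * (B ω * A ω)) F,
    integral_prod_mul F (fun ω => F ω * (B ω * A ω)),
    integral_prod_mul (fun ω => F ω * A ω) (fun ω => F ω * B ω),
    integral_prod_mul (fun ω => F ω * B ω) (fun ω => F ω * A ω)] at h0
  simp only [mul_comm (A _) (B _)]
  linarith

theorem IsGaussianSpace.isMultiplier_exp_mul_exp (hH : IsGaussianSpace P H) {W : Ω → ℝ}
    (hW : IsGinibre P H W) : IsMultiplier (P.prod P) (pairProducts H)
      fun q => Real.exp (W q.1) * Real.exp (W q.2) := by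
  simpa only [← Real.exp_add] using hW.add.exp hH.bounded_of_mem_pairProducts

/-- `e^a - e^b = 2 e^{(a+b)/2} sinh((a-b)/2)`, and both `exp` and `sinh` have nonnegative Taylor
coefficients. -/
theorem IsGaussianSpace.isMultiplier_exp_sub_exp (hH : IsGaussianSpace P H) {W : Ω → ℝ}
    (hW : IsGinibre P H W) : IsMultiplier (P.prod P) (pairProducts H)
      fun q => Real.exp (W q.1) - Real.exp (W q.2) := by
  have hT := hH.bounded_of_mem_pairProducts
  have half : IsMultiplier (P.prod P) (pairProducts H) fun _ => (1 / 2 : ℝ) :=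
    IsMultiplier.const (by norm_num)
  have h := (IsMultiplier.const zero_le_two).mul
    (((half.mul hW.add).exp hT).mul ((half.mul hW.sub).sinh hT))
  convert h using 2 with q
  rw [Real.sinh_eq]
  have e1 : W q.1 = 1 / 2 * (W q.1 + W q.2) + 1 / 2 * (W q.1 - W q.2) := by ring
  have e2 : W q.2 = 1 / 2 * (W q.1 + W q.2) + -(1 / 2 * (W q.1 - W q.2)) := by ring
  conv_lhs => rw [e1, e2, Real.exp_add, Real.exp_add]
  ring_nf

theorem IsMultiplier.mem_dualCone (hH : IsGaussianSpace P H) {h : Ω × Ω → ℝ}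
    (hh : IsMultiplier (P.prod P) (pairProducts H) h) :
    h ∈ dualCone (P.prod P) (pairProducts H) := by
  simpa using hh.mul_mem _ hH.one_mem_dualCone

theorem IsGaussianSpace.integral_exp_mul_le (hH : IsGaussianSpace P H) {W₁ W₂ : Ω → ℝ}
    (h₁ : IsGinibre P H W₁) (h₂ : IsGinibre P H W₂) :
    (∫ ω, Real.exp (W₁ ω) ∂P) * ∫ ω, Real.exp (W₂ ω) ∂P ≤ ∫ ω, Real.exp (W₁ ω + W₂ ω) ∂P := by
  have := hH.isProbabilityMeasure
  -- The weight is trivial here: the two exponentials are the observables under the free measure.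
  have h := hH.integral_mul_integral_le (F := fun _ => 1) measurable_const ⟨1, fun _ => by simp⟩
    (by simpa using IsMultiplier.const zero_le_one) h₂.measurable.exp h₂.exists_exp_le
    (hH.isMultiplier_exp_sub_exp h₂) h₁.integrable_exp
    ((hH.isMultiplier_exp_sub_exp h₁).mem_dualCone hH)
  simpa [Real.exp_add] using h

theorem truncated_tilted_eq (P : Measure Ω) (W A B : Ω → ℝ)
    (hZ : (∫ ω, Real.exp (W ω) ∂P) ≠ 0) :
    truncated (P.tilted W) A B = ((∫ ω, Real.exp (W ω) ∂P) * ∫ ω, Real.exp (W ω) * (A ω * B ω) ∂P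
      - (∫ ω, Real.exp (W ω) * A ω ∂P) * ∫ ω, Real.exp (W ω) * B ω ∂P)
        / (∫ ω, Real.exp (W ω) ∂P) ^ 2 := by
  have h : ∀ g : Ω → ℝ, ∫ ω, g ω ∂(P.tilted W)
      = (∫ ω, Real.exp (W ω) * g ω ∂P) / ∫ ω, Real.exp (W ω) ∂P := fun g => by
    rw [integral_tilted, ← integral_div]
    congr 1
    ext ω
    rw [smul_eq_mul]
    ring
  rw [truncated, h, h, h]
  field_simp

theorem IsGaussianSpace.truncated_nonneg (hH : IsGaussianSpace P H) {W A B : Ω → ℝ}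
    (hW : IsGinibre P H W) (hB : IsGinibre P H B) (hA : Integrable A P)
    (hAA : (fun q : Ω × Ω => A q.1 - A q.2) ∈ dualCone (P.prod P) (pairProducts H)) :
    0 ≤ truncated (P.tilted W) A B := by
  have := hH.isProbabilityMeasure
  rw [truncated_tilted_eq _ _ _ _ (integral_exp_pos hW.integrable_exp).ne']
  have h := hH.integral_mul_integral_le hW.measurable.exp hW.exists_exp_le
    (hH.isMultiplier_exp_mul_exp hW) hB.measurable hB.bounded hB.sub hA hAA
  exact div_nonneg (sub_nonneg.2 h) (sq_nonneg _)

theorem IsGaussianSpace.truncated_nonneg_of_isGinibre (hH : IsGaussianSpace P H) {W A B : Ω → ℝ}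
    (hW : IsGinibre P H W) (hA : IsGinibre P H A) (hB : IsGinibre P H B) :
    0 ≤ truncated (P.tilted W) A B := by
  have := hH.isProbabilityMeasure
  refine hH.truncated_nonneg hW hB ?_ (hA.sub.mem_dualCone hH)
  simpa using integrable_bounded_mul hA.measurable hA.bounded (integrable_const (μ := P) (1 : ℝ))

theorem IsGaussianSpace.truncated_nonpos (hH : IsGaussianSpace P H) {W A B : Ω → ℝ}
    (hW : IsGinibre P H W) (hB : IsGinibre P H B) (hA : Integrable A P)
    (hAA : (fun q : Ω × Ω => A q.2 - A q.1) ∈ dualCone (P.prod P) (pairProducts H)) :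
    truncated (P.tilted W) A B ≤ 0 := by
  have h := hH.truncated_nonneg (A := fun ω => -A ω) hW hB hA.neg
    (by convert hAA using 2 with q; ring)
  simp only [truncated, neg_mul, integral_neg] at h ⊢
  linarith

theorem IsGaussianSpace.truncated_sq_nonpos (hH : IsGaussianSpace P H) {W B Y : Ω → ℝ}
    (hW : IsGinibre P H W) (hB : IsGinibre P H B) (hY : Y ∈ H) :
    truncated (P.tilted W) (fun ω => Y ω ^ 2) B ≤ 0 := by
  have := hH.isProbabilityMeasure
  have hi : Integrable (fun ω => Y ω ^ 2) P := (hH.memLp hY).integrable_sq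
  refine hH.truncated_nonpos hW hB hi ?_
  -- The positive difference is second minus first, opposite to the cosines; hence the reversed sign
  -- of the correlation.
  have he : (fun q : Ω × Ω => Y q.2 ^ 2 - Y q.1 ^ 2) = fun q => 4 * pairFactor (fun x => x) Y q := by
    ext q
    simp only [pairFactor]
    ring
  have hp : Integrable (fun q : Ω × Ω => Y q.2 ^ 2 - Y q.1 ^ 2) (P.prod P) :=
    (hi.comp_snd P).sub (hi.comp_fst P)
  have hp' : Integrable (pairFactor (fun x => x) Y) (P.prod P) := by
    rw [he] at hp
    simpa [← mul_assoc] using hp.const_mul (1 / 4)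
  rw [he]
  exact (IsMultiplier.const (by norm_num)).mul_mem _
    (hH.pairFactor_mem_dualCone measurable_id hY hp')

theorem IsGaussianSpace.integrable_cosh (hH : IsGaussianSpace P H) {Y : Ω → ℝ} (hY : Y ∈ H) :
    Integrable (fun ω => Real.cosh (Y ω)) P := by
  simp only [Real.cosh_eq]
  exact ((hH.integrable_exp hY).add (hH.integrable_exp (H.neg_mem hY))).div_const 2

theorem IsGaussianSpace.integrable_sinh (hH : IsGaussianSpace P H) {Y : Ω → ℝ} (hY : Y ∈ H) :
    Integrable (fun ω => Real.sinh (Y ω)) P := by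
  simp only [Real.sinh_eq]
  exact ((hH.integrable_exp hY).sub (hH.integrable_exp (H.neg_mem hY))).div_const 2

theorem IsGaussianSpace.truncated_cosh_nonpos (hH : IsGaussianSpace P H) {W B Y : Ω → ℝ}
    (hW : IsGinibre P H W) (hB : IsGinibre P H B) (hY : Y ∈ H) :
    truncated (P.tilted W) (fun ω => Real.cosh (Y ω)) B ≤ 0 := by
  have := hH.isProbabilityMeasure
  have hi := hH.integrable_cosh hY
  refine hH.truncated_nonpos hW hB hi ?_
  have he : (fun q : Ω × Ω => Real.cosh (Y q.2) - Real.cosh (Y q.1))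
      = fun q => 2 * pairFactor Real.sinh Y q := by
    ext q
    have e1 : Y q.2 = (Y q.1 + Y q.2) / 2 + (Y q.2 - Y q.1) / 2 := by ring
    have e2 : Y q.1 = (Y q.1 + Y q.2) / 2 - (Y q.2 - Y q.1) / 2 := by ring
    conv_lhs => rw [e1, e2, Real.cosh_add, Real.cosh_sub]
    simp only [pairFactor]
    ring_nf
  have hp : Integrable (fun q : Ω × Ω => Real.cosh (Y q.2) - Real.cosh (Y q.1)) (P.prod P) :=
    (hi.comp_snd P).sub (hi.comp_fst P)
  have hp' : Integrable (pairFactor Real.sinh Y) (P.prod P) := by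
    rw [he] at hp
    simpa [← mul_assoc] using hp.const_mul (1 / 2)
  rw [he]
  exact (IsMultiplier.const (by norm_num)).mul_mem _
    (hH.pairFactor_mem_dualCone Real.measurable_sinh hY hp')

/-- Both `s(Y)` and `-s(Y)` lie in the cone, and a multiplier keeps them there; testing against `1`
gives two opposite inequalities. This replaces the symmetry `φ ↦ -φ`, which need not be realized by
a map of `Ω`. -/
theorem IsGaussianSpace.integral_odd_mul_eq_zero (hH : IsGaussianSpace P H) {s : ℝ → ℝ}
    (hs : Measurable s) (hodd : ∀ x, s (-x) = -s x) {Y B : Ω → ℝ} (hY : Y ∈ H)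
    (hi : Integrable (fun ω => s (Y ω)) P) (hB : IsMultiplier P (cosProducts H) B) :
    ∫ ω, B ω * s (Y ω) ∂P = 0 := by
  have h1 : (fun _ => (1 : ℝ)) ∈ cosProducts H := ⟨0, fun _ => 0, fun i => i.elim0, by simp⟩
  have a := (hB.mul_mem _ (hH.odd_mem_dualCone hs hodd hY hi)).2 _ h1
  have b := (hB.mul_mem _ (hH.odd_mem_dualCone (s := fun x => -s x) hs.neg
    (fun x => by rw [hodd]) hY hi.neg)).2 _ h1
  simp only [one_mul, mul_neg, integral_neg] at a b
  linarith

theorem IsGaussianSpace.integral_tilted_odd_mul (hH : IsGaussianSpace P H) {s : ℝ → ℝ}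
    (hs : Measurable s) (hodd : ∀ x, s (-x) = -s x) {W Y B : Ω → ℝ} (hW : IsGinibre P H W)
    (hY : Y ∈ H) (hi : Integrable (fun ω => s (Y ω)) P) (hB : IsMultiplier P (cosProducts H) B) :
    ∫ ω, s (Y ω) * B ω ∂(P.tilted W) = 0 := by
  have h := hH.integral_odd_mul_eq_zero hs hodd hY hi
    ((hW.single.exp hH.bounded_of_mem_cosProducts).mul hB)
  rw [integral_tilted]
  have e : ∀ ω, (Real.exp (W ω) / ∫ x, Real.exp (W x) ∂P) • (s (Y ω) * B ω)
      = (Real.exp (W ω) * B ω * s (Y ω)) / ∫ x, Real.exp (W x) ∂P := fun ω => by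
    rw [smul_eq_mul]; ring
  simp only [e]
  rw [integral_div, h, zero_div]

/-- In `e^Y = cosh Y + sinh Y` the odd part contributes nothing to either expectation, so only `cosh
Y` remains. -/
theorem IsGaussianSpace.truncated_exp_nonpos (hH : IsGaussianSpace P H) {W B Y : Ω → ℝ}
    (hW : IsGinibre P H W) (hB : IsGinibre P H B) (hY : Y ∈ H) :
    truncated (P.tilted W) (fun ω => Real.exp (Y ω)) B ≤ 0 := by
  have := hH.isProbabilityMeasure
  refine le_of_eq_of_le ?_ (hH.truncated_cosh_nonpos hW hB hY)
  have c := hW.truncatedExists (hH.integrable_cosh hY) hB.measurable hB.bounded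
  have s := hW.truncatedExists (hH.integrable_sinh hY) hB.measurable hB.bounded
  have h1 := hH.integral_tilted_odd_mul Real.measurable_sinh Real.sinh_neg hW hY
    (hH.integrable_sinh hY) hB.single
  have h2 := hH.integral_tilted_odd_mul Real.measurable_sinh Real.sinh_neg hW hY
    (hH.integrable_sinh hY) (IsMultiplier.const zero_le_one)
  simp only [mul_one] at h2
  simp only [truncated, ← Real.cosh_add_sinh, add_mul]
  rw [integral_add c.2.2 s.2.2, integral_add c.1 s.1, h1, h2, add_zero, add_zero]

theorem IsGaussianSpace.truncated_cexp (hH : IsGaussianSpace P H) {W B Y : Ω → ℝ}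
    (hW : IsGinibre P H W) (hB : IsGinibre P H B) (hY : Y ∈ H) :
    truncated (P.tilted W) (fun ω => Complex.exp (Complex.I * Y ω)) (fun ω => (B ω : ℂ))
      = (truncated (P.tilted W) (fun ω => Real.cos (Y ω)) B : ℝ) := by
  have := hH.isProbabilityMeasure
  have hm := hH.measurable _ hY
  have hsin : Integrable (fun ω => Real.sin (Y ω)) P :=
    Integrable.of_bound (Real.measurable_sin.comp hm).aestronglyMeasurable 1
      (Filter.Eventually.of_forall fun _ => Real.abs_sin_le_one _)
  have hcos : Integrable (fun ω => Real.cos (Y ω)) P :=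
    Integrable.of_bound (Real.measurable_cos.comp hm).aestronglyMeasurable 1
      (Filter.Eventually.of_forall fun _ => Real.abs_cos_le_one _)
  have c := hW.truncatedExists hcos hB.measurable hB.bounded
  have s := hW.truncatedExists hsin hB.measurable hB.bounded
  have h1 := hH.integral_tilted_odd_mul Real.measurable_sin Real.sin_neg hW hY hsin hB.single
  have h2 := hH.integral_tilted_odd_mul Real.measurable_sin Real.sin_neg hW hY hsin
    (IsMultiplier.const zero_le_one)
  simp only [mul_one] at h2
  have e : ∀ ω, Complex.exp (Complex.I * Y ω)
      = (Real.cos (Y ω) : ℂ) + (Real.sin (Y ω) : ℂ) * Complex.I := fun ω => by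
    rw [mul_comm, Complex.exp_mul_I, Complex.ofReal_cos, Complex.ofReal_sin]
  have e1 : ∫ ω, Complex.exp (Complex.I * Y ω) ∂(P.tilted W)
      = ((∫ ω, Real.cos (Y ω) ∂(P.tilted W) : ℝ) : ℂ) := by
    simp only [e]
    rw [integral_add c.1.ofReal (s.1.ofReal.mul_const _), integral_mul_const,
      integral_complex_ofReal, integral_complex_ofReal, h2]
    simp
  have e2 : ∫ ω, Complex.exp (Complex.I * Y ω) * (B ω : ℂ) ∂(P.tilted W)
      = ((∫ ω, Real.cos (Y ω) * B ω ∂(P.tilted W) : ℝ) : ℂ) := by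
    have e3 : ∀ ω, Complex.exp (Complex.I * Y ω) * (B ω : ℂ)
        = ((Real.cos (Y ω) * B ω : ℝ) : ℂ) + ((Real.sin (Y ω) * B ω : ℝ) : ℂ) * Complex.I :=
      fun ω => by rw [e]; push_cast; ring
    simp only [e3]
    rw [integral_add c.2.2.ofReal (s.2.2.ofReal.mul_const _), integral_mul_const,
      integral_complex_ofReal, integral_complex_ofReal, h1]
    simp
  rw [truncated, e1, e2, integral_complex_ofReal, truncated]
  push_cast
  rfl

end Ginibre

/-! ### The `L²`-closure of a centred Gaussian process is a Gaussian space. -/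

section Closure

variable {Ω : Type*} [MeasurableSpace Ω]

/-- The measurable functions representing the elements of a subspace of `L²`. -/
def measurableLift {P : Measure Ω} (V : Submodule ℝ (Lp ℝ 2 P)) : Submodule ℝ (Ω → ℝ) where
  carrier := {Y | Measurable Y ∧ ∃ h : MemLp Y 2 P, h.toLp Y ∈ V}
  add_mem' := by
    rintro Y Z ⟨hY, hY2, hYV⟩ ⟨hZ, hZ2, hZV⟩
    exact ⟨hY.add hZ, hY2.add hZ2, by rw [MemLp.toLp_add hY2 hZ2]; exact V.add_mem hYV hZV⟩
  zero_mem' := ⟨measurable_const, MemLp.zero, by rw [MemLp.toLp_zero]; exact V.zero_mem⟩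
  smul_mem' := by
    rintro c Y ⟨hY, hY2, hYV⟩
    exact ⟨hY.const_smul c, hY2.const_smul c, by
      rw [MemLp.toLp_const_smul c hY2]; exact V.smul_mem c hYV⟩

theorem norm_exp_I_mul_sub_le (a b : ℝ) :
    ‖Complex.exp (Complex.I * a) - Complex.exp (Complex.I * b)‖ ≤ ‖a - b‖ := by
  have h : Complex.exp (Complex.I * a) - Complex.exp (Complex.I * b)
      = Complex.exp (Complex.I * b) * (Complex.exp (Complex.I * ((a - b : ℝ) : ℂ)) - 1) := by
    rw [mul_sub, mul_one, ← Complex.exp_add]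
    push_cast
    ring_nf
  rw [h, norm_mul, Complex.norm_exp_I_mul_ofReal, one_mul]
  exact Real.norm_exp_I_mul_ofReal_sub_one_le

theorem integrable_exp_I_mul {P : Measure Ω} [IsFiniteMeasure P] {f : Ω → ℝ}
    (hf : AEStronglyMeasurable f P) : Integrable (fun ω => Complex.exp (Complex.I * f ω)) P := by
  have h : AEMeasurable f P := hf.aemeasurable
  refine Integrable.of_bound (C := 1) ?_ (Filter.Eventually.of_forall fun ω => ?_)
  · exact (Complex.measurable_exp.comp_aemeasurable
      ((Complex.measurable_ofReal.comp_aemeasurable h).const_mul Complex.I)).aestronglyMeasurable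
  · exact (Complex.norm_exp_I_mul_ofReal _).le

/-- The map is `1`-Lipschitz, since `|e^{ia} - e^{ib}| ≤ |a - b|` and the `L¹` norm is below the
`L²` norm on a probability space. -/
theorem continuous_integral_exp_I_mul (P : Measure Ω) [IsProbabilityMeasure P] :
    Continuous fun v : Lp ℝ 2 P => ∫ ω, Complex.exp (Complex.I * v ω) ∂P := by
  refine LipschitzWith.continuous (K := 1) (LipschitzWith.of_dist_le_mul fun v v' => ?_)
  have hi := Lp.memLp (v - v')
  have h1 := hi.mono_exponent (p := 1) (by norm_num)
  rw [dist_eq_norm, dist_eq_norm, NNReal.coe_one, one_mul,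
    ← integral_sub (integrable_exp_I_mul (Lp.aestronglyMeasurable v))
      (integrable_exp_I_mul (Lp.aestronglyMeasurable v'))]
  have h2 : ‖∫ ω, Complex.exp (Complex.I * v ω) - Complex.exp (Complex.I * v' ω) ∂P‖
      ≤ ∫ ω, ‖(v - v') ω‖ ∂P := by
    refine norm_integral_le_of_norm_le (h1.integrable le_rfl).norm ?_
    filter_upwards [Lp.coeFn_sub v v'] with ω hω
    rw [hω]
    exact norm_exp_I_mul_sub_le _ _
  refine h2.trans ?_
  rw [integral_norm_eq_lintegral_enorm (Lp.aestronglyMeasurable _), Lp.norm_def,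
    ← eLpNorm_one_eq_lintegral_enorm]
  exact ENNReal.toReal_mono (Lp.eLpNorm_ne_top _)
    (eLpNorm_le_eLpNorm_of_exponent_le (by norm_num) (Lp.aestronglyMeasurable _))

variable {P : Measure Ω} {T : Type*} {X : T → Ω → ℝ}

theorem exists_finsupp_of_mem_span (hX : ∀ t, MemLp (X t) 2 P) {v : Lp ℝ 2 P}
    (hv : v ∈ Submodule.span ℝ (Set.range fun t => (hX t).toLp (X t))) :
    ∃ c : T →₀ ℝ, v =ᵐ[P] fun ω => ∑ t ∈ c.support, c t * X t ω := by
  obtain ⟨c, rfl⟩ := Finsupp.mem_span_range_iff_exists_finsupp.1 hv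
  refine ⟨c, ?_⟩
  have h : ∀ s : Finset T, (∑ t ∈ s, c t • (hX t).toLp (X t) : Lp ℝ 2 P)
      =ᵐ[P] fun ω => ∑ t ∈ s, c t * X t ω := fun s => by
    classical
    induction s using Finset.induction_on with
    | empty =>
      simp only [Finset.sum_empty]
      exact Lp.coeFn_zero ℝ 2 P
    | insert a s ha ih =>
      simp only [Finset.sum_insert ha]
      filter_upwards [Lp.coeFn_add (c a • (hX a).toLp (X a)) (∑ t ∈ s, c t • (hX t).toLp (X t)),
        Lp.coeFn_smul (c a) ((hX a).toLp (X a)), (hX a).coeFn_toLp, ih] with ω h1 h2 h3 h4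
      rw [h1, Pi.add_apply, h2, Pi.smul_apply, h3, h4, smul_eq_mul]
  exact h c.support

theorem norm_sq_eq_integral_sq (v : Lp ℝ 2 P) : ‖v‖ ^ 2 = ∫ ω, v ω ^ 2 ∂P := by
  rw [← real_inner_self_eq_norm_sq, L2.inner_def]
  simp [sq]

/-- The identity is a closed condition on `v`. On the span it is the characteristic function of a
centred Gaussian whose variance is the squared norm. -/
theorem integral_exp_I_mul_of_mem_closure (hG : IsGaussianProcess X P)
    (h0 : ∀ t, ∫ ω, X t ω ∂P = 0) (hX : ∀ t, MemLp (X t) 2 P) {v : Lp ℝ 2 P}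
    (hv : v ∈ (Submodule.span ℝ (Set.range fun t => (hX t).toLp (X t))).topologicalClosure)
    [IsProbabilityMeasure P] :
    ∫ ω, Complex.exp (Complex.I * v ω) ∂P = Complex.exp (-(((‖v‖ ^ 2 : ℝ) : ℂ) / 2)) := by
  have hcl : IsClosed {v : Lp ℝ 2 P | ∫ ω, Complex.exp (Complex.I * v ω) ∂P
      = Complex.exp (-(((‖v‖ ^ 2 : ℝ) : ℂ) / 2))} :=
    isClosed_eq (continuous_integral_exp_I_mul P) (by fun_prop)
  have hsub : ((Submodule.span ℝ (Set.range fun t => (hX t).toLp (X t)) : Submodule ℝ (Lp ℝ 2 P)) :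
      Set (Lp ℝ 2 P)) ⊆ {v : Lp ℝ 2 P | ∫ ω, Complex.exp (Complex.I * v ω) ∂P
      = Complex.exp (-(((‖v‖ ^ 2 : ℝ) : ℂ) / 2))} := by
    intro v hv
    obtain ⟨c, hc⟩ := exists_finsupp_of_mem_span hX hv
    have hg : HasGaussianLaw (fun ω => ∑ t ∈ c.support, c t * X t ω) P :=
      (hG.smul c).hasGaussianLaw_fun_sum
    have hgv : HasGaussianLaw v P := hg.congr hc.symm
    have hmean : ∫ ω, v ω ∂P = 0 := by
      rw [integral_congr_ae hc, integral_finsetSum _ fun t _ =>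
        ((hX t).integrable (by norm_num)).const_mul _]
      simp [integral_const_mul, h0]
    have h := hgv.charFun_map_eq 1
    rw [charFun_apply_real, integral_map hgv.aemeasurable (by fun_prop)] at h
    simp only [RCLike.inner_apply, conj_trivial, mul_one, Complex.ofReal_one, one_mul] at h
    have hvar : Var[fun ω => v ω; P] = ‖v‖ ^ 2 := by
      rw [variance_of_integral_eq_zero hgv.aemeasurable hmean, norm_sq_eq_integral_sq]
    rw [hvar, hmean] at h
    simp only [Set.mem_ofPred_eq]
    simp only [mul_comm Complex.I, h]
    congr 1
    push_cast
    ring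
  exact closure_minimal hsub hcl hv

theorem isGaussianSpace_closure (hG : IsGaussianProcess X P)
    (h0 : ∀ t, ∫ ω, X t ω ∂P = 0) (hX : ∀ t, MemLp (X t) 2 P) [IsProbabilityMeasure P] :
    IsGaussianSpace P (measurableLift
      (Submodule.span ℝ (Set.range fun t => (hX t).toLp (X t))).topologicalClosure) := by
  refine ⟨fun Y hY => hY.1, ?_⟩
  rintro Y ⟨hm, h2, hV⟩
  refine ⟨‖h2.toLp Y‖₊ ^ 2, ?_⟩
  have : IsProbabilityMeasure (P.map Y) := Measure.isProbabilityMeasure_map hm.aemeasurable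
  refine Measure.ext_of_charFun ?_
  ext t
  -- Applying the identity to `t • Y` recovers the whole characteristic function of `Y`.
  have h := integral_exp_I_mul_of_mem_closure hG h0 hX
    (Submodule.smul_mem _ t hV)
  rw [charFun_gaussianReal, charFun_apply_real, integral_map hm.aemeasurable (by fun_prop)]
  have e : ∫ ω, Complex.exp ((t : ℂ) * Y ω * Complex.I) ∂P
      = ∫ ω, Complex.exp (Complex.I * ((t • h2.toLp Y : Lp ℝ 2 P) ω : ℝ)) ∂P := by
    refine integral_congr_ae ?_
    filter_upwards [Lp.coeFn_smul t (h2.toLp Y), h2.coeFn_toLp] with ω h1 h3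
    rw [h1, Pi.smul_apply, h3, smul_eq_mul]
    push_cast
    ring_nf
  rw [e, h]
  congr 1
  rw [norm_smul, mul_pow, Real.norm_eq_abs, sq_abs]
  push_cast [coe_nnnorm]
  ring

end Closure

/-! ### Weighted integrals of square-integrable families. -/

section Smearing

variable {Ω K : Type*} [MeasurableSpace Ω] [MeasurableSpace K] {P : Measure Ω} {κ : Measure K}
  {g : K → ℝ} {F : K → Ω → ℝ}

/-- Cauchy–Schwarz in `τ` for each fixed `ω`, followed by Tonelli. -/
theorem memLp_integral_mul [SFinite κ] [SFinite P] (hg : MemLp g 2 κ)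
    (hF : Measurable fun q : K × Ω => F q.1 q.2)
    (hF2 : MemLp (fun q : K × Ω => F q.1 q.2) 2 (κ.prod P)) :
    MemLp (fun ω => ∫ τ, g τ * F τ ω ∂κ) 2 P := by
  refine ⟨(measurable_integral_weight hg.aestronglyMeasurable hF).aestronglyMeasurable, ?_⟩
  rw [eLpNorm_lt_top_iff_lintegral_rpow_enorm_lt_top (by norm_num) (by norm_num)]
  have h2 := (eLpNorm_lt_top_iff_lintegral_rpow_enorm_lt_top (by norm_num) (by norm_num)).1 hF2.2
  have hg2 := (eLpNorm_lt_top_iff_lintegral_rpow_enorm_lt_top (by norm_num) (by norm_num)).1 hg.2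
  simp only [ENNReal.toReal_ofNat] at h2 hg2 ⊢
  rw [lintegral_prod_symm _ (by fun_prop)] at h2
  refine lt_of_le_of_lt (b := ∫⁻ ω, (∫⁻ τ, ‖g τ‖ₑ ^ (2 : ℝ) ∂κ) *
    ∫⁻ τ, ‖F τ ω‖ₑ ^ (2 : ℝ) ∂κ ∂P) (lintegral_mono fun ω => ?_) ?_
  · have hFω : Measurable fun τ => F τ ω := hF.comp (f := fun τ => (τ, ω)) measurable_prodMk_right
    have h3 : ‖∫ τ, g τ * F τ ω ∂κ‖ₑ ≤ (∫⁻ τ, ‖g τ‖ₑ ^ (2 : ℝ) ∂κ) ^ (1 / (2 : ℝ))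
        * (∫⁻ τ, ‖F τ ω‖ₑ ^ (2 : ℝ) ∂κ) ^ (1 / (2 : ℝ)) := by
      refine (enorm_integral_le_lintegral_enorm _).trans ?_
      simp only [enorm_mul]
      exact ENNReal.lintegral_mul_le_Lp_mul_Lq κ Real.HolderConjugate.two_two
        hg.aestronglyMeasurable.enorm hFω.enorm.aemeasurable
    refine (ENNReal.rpow_le_rpow h3 zero_le_two).trans_eq ?_
    rw [ENNReal.mul_rpow_of_nonneg _ _ zero_le_two, ← ENNReal.rpow_mul, ← ENNReal.rpow_mul]
    norm_num
  · rw [lintegral_const_mul' _ _ hg2.ne]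
    exact ENNReal.mul_lt_top hg2 h2

theorem integral_mul_integral_mul [SFinite κ] [SFinite P] (hg : MemLp g 2 κ)
    (hF2 : MemLp (fun q : K × Ω => F q.1 q.2) 2 (κ.prod P)) {ψ : Ω → ℝ} (hψ : MemLp ψ 2 P) :
    ∫ ω, ψ ω * ∫ τ, g τ * F τ ω ∂κ ∂P = ∫ τ, g τ * ∫ ω, ψ ω * F τ ω ∂P ∂κ := by
  have h1 : MemLp (fun q : K × Ω => g q.1 * ψ q.2) 2 (κ.prod P) := by
    refine (memLp_two_iff_integrable_sq
      (hg.aestronglyMeasurable.comp_fst.mul hψ.aestronglyMeasurable.comp_snd)).2 ?_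
    simpa only [Pi.mul_apply, mul_pow] using hg.integrable_sq.mul_prod hψ.integrable_sq
  have h2 : Integrable (Function.uncurry fun τ ω => g τ * (ψ ω * F τ ω)) (κ.prod P) := by
    refine (h1.integrable_mul hF2).congr (Filter.Eventually.of_forall fun q => ?_)
    simp only [Pi.mul_apply, Function.uncurry]
    ring
  simp only [← integral_const_mul]
  rw [integral_integral_swap h2]
  simp only [mul_left_comm]

/-- By Fubini the integral is orthogonal to everything orthogonal to all `F τ`, hence lies in `Vᗮᗮ =
V`. This avoids treating `τ ↦ F τ` as an `L²`-valued integrand. -/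
theorem integral_mul_mem_measurableLift [SFinite κ] [SFinite P] {V : Submodule ℝ (Lp ℝ 2 P)}
    (hV : IsClosed (V : Set (Lp ℝ 2 P))) (hg : MemLp g 2 κ)
    (hF : Measurable fun q : K × Ω => F q.1 q.2)
    (hF2 : MemLp (fun q : K × Ω => F q.1 q.2) 2 (κ.prod P)) (hFV : ∀ τ, F τ ∈ measurableLift V) :
    (fun ω => ∫ τ, g τ * F τ ω ∂κ) ∈ measurableLift V := by
  have hL := memLp_integral_mul hg hF hF2
  refine ⟨measurable_integral_weight hg.aestronglyMeasurable hF, hL, ?_⟩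
  have : CompleteSpace V := hV.completeSpace_coe
  rw [← V.orthogonal_orthogonal, Submodule.mem_orthogonal]
  intro ψ hψ
  have h0 : ∀ τ, ∫ ω, ψ ω * F τ ω ∂P = 0 := fun τ => by
    obtain ⟨-, h2, h3⟩ := hFV τ
    have h := Submodule.inner_left_of_mem_orthogonal h3 hψ
    rw [L2.inner_def] at h
    rw [← h]
    refine integral_congr_ae ?_
    filter_upwards [h2.coeFn_toLp] with ω hω
    simp [hω, mul_comm]
  have h := integral_mul_integral_mul hg hF2 (Lp.memLp ψ)
  simp only [h0, mul_zero, integral_zero] at h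
  rw [L2.inner_def, ← h]
  refine integral_congr_ae ?_
  filter_upwards [hL.coeFn_toLp] with ω hω
  simp [hω, mul_comm]

end Smearing

/-! ### Translated mollifiers and uniform bounds on the regularized variance. -/

section Mollifier

variable {d : ℕ} {ε : ℝ} {χ : Space d → ℝ}

theorem mollifierAt_eq_vadd (hχ : IsMollifier ε χ) (x : Space d) :
    mollifierAt hχ x = DomAddAct.mk (-x) +ᵥ mollifierAt hχ 0 := by
  rw [mollifierAt, mollifierAt, DomAddAct.mk_vadd_toLp]
  congr 1
  ext y
  simp [neg_add_eq_sub]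

/-- Translations act continuously on `L²`. This transfers the joint measurability of `φ` to the
regularized field in `(τ, x, ω)`. -/
theorem continuous_mollifierAt (hχ : IsMollifier ε χ) : Continuous (mollifierAt hχ) := by
  have : Fact ((2 : ENNReal) ≠ ⊤) := ⟨by norm_num⟩
  have h : Continuous fun x : Space d => DomAddAct.mk (-x) +ᵥ mollifierAt hχ 0 :=
    (DomAddAct.continuous_mk.comp continuous_neg).vadd continuous_const
  convert h using 2 with x
  exact mollifierAt_eq_vadd hχ x

theorem norm_mollifierAt (hχ : IsMollifier ε χ) (x : Space d) :
    ‖mollifierAt hχ x‖ = ‖mollifierAt hχ 0‖ := by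
  rw [mollifierAt_eq_vadd, DomAddAct.norm_vadd_Lp]

theorem norm_fourierReal_le (f : RealL2 d) : ‖fourierReal f‖ ≤ ‖f‖ := by
  rw [fourierReal, Lp.norm_fourier_eq]
  simpa using Complex.ofRealCLM.norm_compLp_le f

theorem Noncritical.abs_thermalKernelHat_zero_le {β z : ℝ} {E : Space d → ℝ}
    (hE : Noncritical β z E) : ∃ C, ∀ p, |thermalKernelHat β z E 0 p| ≤ C := by
  obtain ⟨q, hq, hE2⟩ := hE.sup_lt_one
  -- At `s = 0` the kernel is `(1 + a)/(1 - a)` with `0 ≤ a ≤ q < 1`.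
  refine ⟨2 / (1 - q), fun p => ?_⟩
  have h0 : 0 ≤ z * Real.exp (-β * E p) := mul_nonneg hE.z_pos.le (Real.exp_pos _).le
  have h1 := hE2 p
  have e : thermalKernelHat β z E 0 p
      = (1 + z * Real.exp (-β * E p)) / (1 - z * Real.exp (-β * E p)) := by
    simp [thermalKernelHat]
  rw [e, abs_of_nonneg (div_nonneg (by linarith) (by linarith))]
  exact div_le_div₀ (by norm_num) (by linarith) (by linarith) (by linarith)

theorem norm_sq_eq_integral_norm_sq (F : Lp ℂ 2 (volume : Measure (Space d))) :
    Integrable (fun ξ => ‖F ξ‖ ^ 2) ∧ ∫ ξ, ‖F ξ‖ ^ 2 = ‖F‖ ^ 2 := by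
  refine ⟨(Lp.memLp F).integrable_norm_pow (by norm_num), ?_⟩
  rw [← inner_self_eq_norm_sq (𝕜 := ℂ) F, L2.inner_def, ← integral_re (L2.integrable_inner F F)]
  simp only [inner_self_eq_norm_sq]

theorem Noncritical.exists_abs_thermalCov_zero_le {β z : ℝ} {E : Space d → ℝ}
    (hE : Noncritical β z E) : ∃ C, 0 ≤ C ∧ ∀ f, |thermalCov β z E 0 f f| ≤ C * ‖f‖ ^ 2 := by
  obtain ⟨C, hC⟩ := hE.abs_thermalKernelHat_zero_le
  have hC0 : 0 ≤ C := (abs_nonneg _).trans (hC 0)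
  refine ⟨C, hC0, fun f => (Complex.abs_re_le_norm _).trans ?_⟩
  obtain ⟨hi, hn⟩ := norm_sq_eq_integral_norm_sq (fourierReal f)
  refine (norm_integral_le_of_norm_le (hi.const_mul C)
    (Filter.Eventually.of_forall fun ξ => ?_)).trans ?_
  · rw [norm_mul, norm_mul, RCLike.norm_conj, ← sq, Complex.norm_real, Real.norm_eq_abs]
    exact mul_le_mul_of_nonneg_right (hC _) (sq_nonneg _)
  · rw [integral_const_mul, hn]
    exact mul_le_mul_of_nonneg_left
      (pow_le_pow_left₀ (norm_nonneg _) (norm_fourierReal_le f) 2) hC0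

theorem Noncritical.exists_abs_regVar_le {β z : ℝ} {E : Space d → ℝ}
    (hE : Noncritical β z E) (hχ : IsMollifier ε χ) : ∃ C, ∀ x, |regVar β z E hχ x| ≤ C := by
  obtain ⟨C, -, hC⟩ := hE.exists_abs_thermalCov_zero_le
  exact ⟨C * ‖mollifierAt hχ 0‖ ^ 2, fun x => by
    rw [← norm_mollifierAt hχ x]; exact hC _⟩

end Mollifier

/-! ### The Gaussian space of the free thermal field. -/

section Field

variable {d : ℕ} {β z : ℝ} {E : Space d → ℝ} {Ω : Type*} [MeasurableSpace Ω]
  {P : Measure Ω} {φ : AddCircle β → RealL2 d → Ω → ℝ}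

theorem IsFreeThermalField.isProbabilityMeasure (hφ : IsFreeThermalField β z E P φ) :
    IsProbabilityMeasure P :=
  hφ.gaussian.isProbabilityMeasure

theorem IsFreeThermalField.measurable_comp (hφ : IsFreeThermalField β z E P φ) {A : Type*}
    [TopologicalSpace A] [MeasurableSpace A] [OpensMeasurableSpace A]
    {h : A → AddCircle β × RealL2 d} (hh : Continuous h) :
    Measurable fun q : A × Ω => φ (h q.1).1 (h q.1).2 q.2 := by
  let : MeasurableSpace (AddCircle β × RealL2 d) := borel _
  have : BorelSpace (AddCircle β × RealL2 d) := ⟨rfl⟩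
  exact hφ.measurable.comp (hh.measurable.prodMap measurable_id)

theorem IsFreeThermalField.measurable_eval (hφ : IsFreeThermalField β z E P φ)
    (τ : AddCircle β) (f : RealL2 d) : Measurable (φ τ f) :=
  (hφ.measurable_comp (A := Unit) (h := fun _ => (τ, f)) continuous_const).comp
    (f := fun ω : Ω => ((), ω)) measurable_prodMk_left

theorem IsFreeThermalField.memLp (hφ : IsFreeThermalField β z E P φ)
    (i : AddCircle β × RealL2 d) : MemLp (φ i.1 i.2) 2 P :=
  (hφ.gaussian.hasGaussianLaw_eval i).memLp_two

/-- The `L²`-closure of the linear span of the field variables. -/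
noncomputable def fieldSpace (hφ : IsFreeThermalField β z E P φ) : Submodule ℝ (Ω → ℝ) :=
  measurableLift (Submodule.span ℝ
    (Set.range fun i => (hφ.memLp i).toLp (φ i.1 i.2))).topologicalClosure

theorem isGaussianSpace_fieldSpace (hφ : IsFreeThermalField β z E P φ) :
    IsGaussianSpace P (fieldSpace hφ) := by
  have := hφ.isProbabilityMeasure
  exact isGaussianSpace_closure hφ.gaussian (fun i => hφ.mean_zero i.1 i.2) hφ.memLp

theorem field_mem_fieldSpace (hφ : IsFreeThermalField β z E P φ) (τ : AddCircle β)
    (f : RealL2 d) : φ τ f ∈ fieldSpace hφ :=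
  ⟨hφ.measurable_eval τ f, hφ.memLp (τ, f),
    Submodule.le_topologicalClosure _ (Submodule.subset_span ⟨(τ, f), rfl⟩)⟩

theorem smeared_mem_fieldSpace [Fact (0 < β)] (hφ : IsFreeThermalField β z E P φ)
    {g : AddCircle β → ℝ} (hg : MemLp g 2 volume) (f : RealL2 d) :
    smeared φ g f ∈ fieldSpace hφ := by
  have := hφ.isProbabilityMeasure
  have hm : Measurable fun q : AddCircle β × Ω => φ q.1 f q.2 :=
    hφ.measurable_comp (h := fun τ => (τ, f)) (by fun_prop)
  have hsq : Integrable (fun q : AddCircle β × Ω => φ q.1 f q.2 ^ 2) (volume.prod P) := by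
    rw [integrable_prod_iff (hm.pow_const 2).aestronglyMeasurable]
    refine ⟨Filter.Eventually.of_forall fun τ => (hφ.memLp (τ, f)).integrable_sq, ?_⟩
    -- Stationarity in `τ` makes the second moment constant, hence integrable over the circle.
    have e : ∀ τ, ∫ ω, ‖φ τ f ω ^ 2‖ ∂P = thermalCov β z E 0 f f := fun τ => by
      have h := hφ.covariance τ τ f f
      rw [sub_self, norm_zero] at h
      rw [← h]
      simp [sq]
    simp only [e]
    exact integrable_const _
  exact integral_mul_mem_measurableLift (Submodule.isClosed_topologicalClosure _) hg hm
    ((memLp_two_iff_integrable_sq hm.aestronglyMeasurable).2 hsq)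
    fun τ => field_mem_fieldSpace hφ τ f

variable {ε : ℝ} {χ : Space d → ℝ}

theorem IsFreeThermalField.measurable_regField (hφ : IsFreeThermalField β z E P φ)
    (hχ : IsMollifier ε χ) :
    Measurable fun q : (AddCircle β × Space d) × Ω => regField φ hχ q.1.1 q.1.2 q.2 :=
  hφ.measurable_comp (h := fun a : AddCircle β × Space d => (a.1, mollifierAt hχ a.2))
    (continuous_fst.prodMk ((continuous_mollifierAt hχ).comp continuous_snd))

theorem IsFreeThermalField.measurable_regVar (hφ : IsFreeThermalField β z E P φ)
    (hχ : IsMollifier ε χ) : Measurable (regVar β z E hχ) := by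
  have := hφ.isProbabilityMeasure
  -- As a second moment of a jointly measurable field, the variance is measurable in `x` without
  -- examining the Fourier integral.
  have e : regVar β z E hχ = fun x => ∫ ω, regField φ hχ 0 x ω ^ 2 ∂P := by
    ext x
    have h := hφ.covariance 0 0 (mollifierAt hχ x) (mollifierAt hχ x)
    rw [sub_self, norm_zero] at h
    rw [regVar, ← h]
    simp [sq, regField]
  rw [e]
  have hm : Measurable fun q : Space d × Ω => regField φ hχ 0 q.1 q.2 ^ 2 :=
    ((hφ.measurable_regField hχ).comp (f := fun q : Space d × Ω => ((0, q.1), q.2))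
      (by fun_prop)).pow_const 2
  exact hm.stronglyMeasurable.integral_prod_right'.measurable

end Field

/-- Sections are integrable only almost everywhere. Passing that integrability to the section
hypothesis lets the lemma be nested to unfold iterated integrals. -/
theorem integral_prod_of_section_eq {A B F : Type*} [MeasurableSpace A] [MeasurableSpace B]
    [NormedAddCommGroup F] [NormedSpace ℝ F] {μ : Measure A} {ν : Measure B} [SFinite μ] [SFinite ν]
    {f : A × B → F} (hf : Integrable f (μ.prod ν)) {G : A → F}
    (h : ∀ a, Integrable (fun b => f (a, b)) ν → ∫ b, f (a, b) ∂ν = G a) :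
    ∫ q, f q ∂(μ.prod ν) = ∫ a, G a ∂μ :=
  (integral_prod f hf).trans (integral_congr_ae (hf.prod_right_ae.mono h))

/-- A volume-indexed family of integrals of cosines of Gaussian variables with nonnegative weights,
over index sets which are superadditive in the volume. -/
def IsCosineFamily {d : ℕ} {Ω : Type*} [MeasurableSpace Ω] (H : Submodule ℝ (Ω → ℝ))
    (W : Set (Space d) → Ω → ℂ) : Prop :=
  ∃ (Θ : Type) (_ : MeasurableSpace Θ) (ν : Measure Θ) (_ : SFinite ν) (w : Θ → ℝ)
    (X : Θ → Ω → ℝ) (T : Set (Space d) → Set Θ),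
    (∀ θ, 0 ≤ w θ) ∧ Measurable (fun q : Θ × Ω => X q.1 q.2) ∧ (∀ θ, X θ ∈ H) ∧
    (∀ Λ, MeasurableSet Λ → Bornology.IsBounded Λ → MeasurableSet (T Λ) ∧ IntegrableOn w (T Λ) ν ∧
      ∀ ω, W Λ ω = ((∫ θ in T Λ, w θ * Real.cos (X θ ω) ∂ν : ℝ) : ℂ)) ∧
    ∀ Λ₁ Λ₂, T Λ₁ ∪ T Λ₂ ⊆ T (Λ₁ ∪ Λ₂) ∧ (volume (Λ₁ ∩ Λ₂) = 0 → ν (T Λ₁ ∩ T Λ₂) = 0)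

/-- A conjugation-invariant integral equals its real part, which replaces each exponential by a
cosine. -/
theorem integral_eq_ofReal_of_conj_eq {Θ : Type*} [MeasurableSpace Θ] {ν : Measure Θ} {w x : Θ → ℝ}
    (hw : Integrable w ν) (hx : Measurable x)
    (hconj : starRingEnd ℂ (∫ θ, (w θ : ℂ) * Complex.exp (Complex.I * x θ) ∂ν)
      = ∫ θ, (w θ : ℂ) * Complex.exp (Complex.I * x θ) ∂ν) :
    ∫ θ, (w θ : ℂ) * Complex.exp (Complex.I * x θ) ∂ν
      = ((∫ θ, w θ * Real.cos (x θ) ∂ν : ℝ) : ℂ) := by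
  have hint : Integrable (fun θ => (w θ : ℂ) * Complex.exp (Complex.I * x θ)) ν :=
    hw.ofReal.mul_bdd (c := 1) (by fun_prop)
      (Filter.Eventually.of_forall fun θ => (Complex.norm_exp_I_mul_ofReal _).le)
  rw [← Complex.conj_eq_iff_re.1 hconj, ← RCLike.re_eq_complex_re, ← integral_re hint]
  congr 2
  ext θ
  rw [RCLike.re_eq_complex_re, Complex.re_ofReal_mul, mul_comm Complex.I,
    Complex.exp_ofReal_mul_I_re]

theorem integrable_ofReal_mul_exp {Θ : Type*} [MeasurableSpace Θ] {ν : Measure Θ} {w x : Θ → ℝ}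
    (hw : Integrable w ν) (hx : Measurable x) :
    Integrable (fun θ => (w θ : ℂ) * Complex.exp (Complex.I * x θ)) ν :=
  hw.ofReal.mul_bdd (c := 1) (by fun_prop)
    (Filter.Eventually.of_forall fun θ => (Complex.norm_exp_I_mul_ofReal _).le)

/-! ### Reality of the interactions, from the evenness of `ρ`. -/

section Conjugation

variable {d : ℕ} {β z : ℝ} {E : Space d → ℝ} {Ω : Type*} {φ : AddCircle β → RealL2 d → Ω → ℝ}
  {ε : ℝ} {χ : Space d → ℝ}

theorem conj_wickExp (hχ : IsMollifier ε χ) (α : ℝ) (τ : AddCircle β) (x : Space d) (ω : Ω) :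
    starRingEnd ℂ (wickExp z E φ hχ α τ x ω) = wickExp z E φ hχ (-α) τ x ω := by
  simp only [wickExp, map_mul, Complex.conj_ofReal, neg_sq, ← Complex.exp_conj, Complex.conj_I]
  push_cast
  ring_nf

variable {ρ : Measure ℝ} [ρ.IsNegInvariant] [Fact (0 < β)] {lam : ℝ}

theorem conj_localPerturbation (hχ : IsMollifier ε χ) (Λ : Set (Space d)) (ω : Ω) :
    starRingEnd ℂ (localPerturbation z E φ hχ lam ρ Λ ω)
      = localPerturbation z E φ hχ lam ρ Λ ω := by
  rw [localPerturbation, map_mul, Complex.conj_ofReal]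
  simp only [← integral_conj, conj_wickExp]
  rw [integral_neg_eq_self fun α => ∫ τ : AddCircle β, ∫ x in Λ, wickExp z E φ hχ α τ x ω]

theorem conj_nonlocalPerturbation (hχ : IsMollifier ε χ) (V : Space d → ℝ)
    (Λ : Set (Space d)) (ω : Ω) :
    starRingEnd ℂ (nonlocalPerturbation z E φ hχ lam ρ V Λ ω)
      = nonlocalPerturbation z E φ hχ lam ρ V Λ ω := by
  rw [nonlocalPerturbation, map_mul, Complex.conj_ofReal]
  simp only [← integral_conj, map_mul, Complex.conj_ofReal, conj_wickExp]
  congr 2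
  ext τ
  rw [integral_neg_eq_self fun α => ∫ α', ∫ x in Λ, ∫ y in Λ,
    wickExp z E φ hχ α τ x ω * (V (x - y) : ℂ) * wickExp z E φ hχ (-α') τ y ω ∂volume ∂volume ∂ρ]
  congr 1
  ext α
  rw [integral_neg_eq_self fun α' => ∫ x in Λ, ∫ y in Λ,
    wickExp z E φ hχ α τ x ω * (V (x - y) : ℂ) * wickExp z E φ hχ α' τ y ω ∂volume ∂volume]

end Conjugation

/-! ### Both interactions as nonnegative mixtures of cosines. -/

section Perturbation

variable {d : ℕ} {β z : ℝ} {E : Space d → ℝ} {Ω : Type*} [MeasurableSpace Ω]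
  {P : Measure Ω} {φ : AddCircle β → RealL2 d → Ω → ℝ} {ε : ℝ} {χ : Space d → ℝ}

theorem regField_mem_fieldSpace (hφ : IsFreeThermalField β z E P φ) (hχ : IsMollifier ε χ)
    (τ : AddCircle β) (x : Space d) : regField φ hχ τ x ∈ fieldSpace hφ :=
  field_mem_fieldSpace hφ τ _

theorem Noncritical.exists_exp_regVar_le {ρ : Measure ℝ} (hE : Noncritical β z E) (hχ : IsMollifier ε χ)
    (hρ : ∃ R : ℝ, ρ {α | R < |α|} = 0) :
    ∃ C, ∀ᵐ α ∂ρ, ∀ x, |Real.exp (α ^ 2 / 2 * regVar β z E hχ x)| ≤ C := by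
  obtain ⟨R, hR⟩ := hρ
  obtain ⟨C, hC⟩ := hE.exists_abs_regVar_le hχ
  have hC0 : 0 ≤ C := (abs_nonneg _).trans (hC 0)
  refine ⟨Real.exp (R ^ 2 / 2 * C), ?_⟩
  have h : ∀ᵐ α ∂ρ, ¬ R < |α| := by simpa [ae_iff] using hR
  filter_upwards [h] with α hα x
  rw [abs_of_pos (Real.exp_pos _), Real.exp_le_exp]
  have h2 : α ^ 2 ≤ R ^ 2 := by
    rw [← sq_abs]
    exact pow_le_pow_left₀ (abs_nonneg _) (not_lt.1 hα) 2
  calc α ^ 2 / 2 * regVar β z E hχ x ≤ α ^ 2 / 2 * C :=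
        mul_le_mul_of_nonneg_left ((le_abs_self _).trans (hC x)) (by positivity)
    _ ≤ R ^ 2 / 2 * C := by gcongr

variable {ρ : Measure ℝ} [IsFiniteMeasure ρ] [ρ.IsNegInvariant] [Fact (0 < β)] {lam : ℝ}

theorem isCosineFamily_localPerturbation (hE : Noncritical β z E)
    (hφ : IsFreeThermalField β z E P φ) (hχ : IsMollifier ε χ)
    (hρ : ∃ R : ℝ, ρ {α | R < |α|} = 0) (hlam : 0 < lam) :
    IsCosineFamily (fieldSpace hφ) (localPerturbation z E φ hχ lam ρ) := by
  let w : ℝ × AddCircle β × Space d → ℝ :=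
    fun θ => lam * Real.exp (θ.1 ^ 2 / 2 * regVar β z E hχ θ.2.2)
  let X : ℝ × AddCircle β × Space d → Ω → ℝ := fun θ ω => θ.1 * regField φ hχ θ.2.1 θ.2.2 ω
  have hrv := hφ.measurable_regVar hχ
  have hw : Measurable w := by fun_prop
  have hX : Measurable fun q : (ℝ × AddCircle β × Space d) × Ω => X q.1 q.2 :=
    (by fun_prop : Measurable fun q : (ℝ × AddCircle β × Space d) × Ω => q.1.1).mul
      ((hφ.measurable_regField hχ).comp
        (f := fun q : (ℝ × AddCircle β × Space d) × Ω => (q.1.2, q.2)) (by fun_prop))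
  refine ⟨ℝ × AddCircle β × Space d, inferInstance, ρ.prod (volume.prod volume), inferInstance,
    w, X, fun Λ => Set.univ ×ˢ (Set.univ ×ˢ Λ), fun θ => by positivity, hX,
    fun θ => Submodule.smul_mem _ _ (regField_mem_fieldSpace hφ hχ _ _), fun Λ hΛ hb => ?_,
    fun Λ₁ Λ₂ => ⟨?_, fun h => ?_⟩⟩
  · have hfin : IsFiniteMeasure (volume.restrict Λ) := ⟨by simpa using hb.measure_lt_top⟩
    have hres : (ρ.prod ((volume : Measure (AddCircle β)).prod volume)).restrict
        (Set.univ ×ˢ (Set.univ ×ˢ Λ)) = ρ.prod (volume.prod (volume.restrict Λ)) := by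
      rw [← Measure.prod_restrict, ← Measure.prod_restrict, Measure.restrict_univ,
        Measure.restrict_univ]
    have hwi : Integrable w (ρ.prod ((volume : Measure (AddCircle β)).prod
        (volume.restrict Λ))) := by
      obtain ⟨C, hC⟩ := hE.exists_exp_regVar_le hχ hρ
      refine Integrable.of_bound hw.aestronglyMeasurable (lam * C) ?_
      filter_upwards [Measure.quasiMeasurePreserving_fst.ae hC] with θ hθ
      rw [Real.norm_eq_abs, abs_mul, abs_of_pos hlam]
      exact mul_le_mul_of_nonneg_left (hθ _) hlam.le
    refine ⟨MeasurableSet.univ.prod (MeasurableSet.univ.prod hΛ), ?_, fun ω => ?_⟩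
    · rwa [IntegrableOn, hres]
    · have hXω : Measurable fun θ => X θ ω :=
        hX.comp (f := fun θ => (θ, ω)) measurable_prodMk_right
      have hi := integrable_ofReal_mul_exp hwi hXω
      have e : ∫ θ, (w θ : ℂ) * Complex.exp (Complex.I * X θ ω)
          ∂(ρ.prod ((volume : Measure (AddCircle β)).prod (volume.restrict Λ)))
          = localPerturbation z E φ hχ lam ρ Λ ω := by
        rw [integral_prod_of_section_eq hi (G := fun α => ∫ τ : AddCircle β, ∫ x in Λ,
          (lam : ℂ) * wickExp z E φ hχ α τ x ω), localPerturbation]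
        · simp only [integral_const_mul]
        · refine fun α h1 => integral_prod_of_section_eq h1 fun τ h2 => ?_
          congr 1
          ext x
          simp only [w, X, wickExp]
          push_cast
          ring_nf
      rw [hres, ← integral_eq_ofReal_of_conj_eq hwi hXω, e]
      rw [e, conj_localPerturbation]
  · rintro θ (h | h)
    · exact ⟨trivial, trivial, Or.inl h.2.2⟩
    · exact ⟨trivial, trivial, Or.inr h.2.2⟩
  · simp [Set.prod_inter_prod, Measure.prod_prod, h]

/-- The shear `(x, y) ↦ (x, x - y)` preserves the product measure with `x ∈ Λ` and `y` unrestricted;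
boundedness of `Λ` makes the `x`-factor finite. -/
theorem integrable_sub_restrict_prod {V : Space d → ℝ} (hV : Integrable V) {Λ : Set (Space d)}
    (hb : Bornology.IsBounded Λ) : Integrable (fun p : Space d × Space d => V (p.1 - p.2))
      ((volume.restrict Λ).prod (volume.restrict Λ)) := by
  have hfin : IsFiniteMeasure (volume.restrict Λ) := ⟨by simpa using hb.measure_lt_top⟩
  have hmp : MeasurePreserving (fun p : Space d × Space d => (p.1, p.1 - p.2))
      ((volume.restrict Λ).prod volume) ((volume.restrict Λ).prod volume) :=
    (MeasurePreserving.id _).skew_product (g := fun x y => x - y) (by fun_prop)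
      (Filter.Eventually.of_forall fun x => (Measure.measurePreserving_sub_left volume x).map_eq)
  have h := hmp.integrable_comp_of_integrable (hV.comp_snd (volume.restrict Λ))
  exact h.mono_measure (Measure.prod_mono le_rfl Measure.restrict_le_self)

theorem isCosineFamily_nonlocalPerturbation (hE : Noncritical β z E)
    (hφ : IsFreeThermalField β z E P φ) (hχ : IsMollifier ε χ)
    (hρ : ∃ R : ℝ, ρ {α | R < |α|} = 0) (hlam : 0 < lam) {V : Space d → ℝ} (hV : Integrable V)
    (hV0 : ∀ x, 0 ≤ V x) :
    IsCosineFamily (fieldSpace hφ) (nonlocalPerturbation z E φ hχ lam ρ V) := by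
  let b : AddCircle β × ℝ × ℝ × Space d × Space d → ℝ :=
    fun θ => lam * Real.exp (θ.2.1 ^ 2 / 2 * regVar β z E hχ θ.2.2.2.1)
      * Real.exp (θ.2.2.1 ^ 2 / 2 * regVar β z E hχ θ.2.2.2.2)
  let w : AddCircle β × ℝ × ℝ × Space d × Space d → ℝ :=
    fun θ => b θ * V (θ.2.2.2.1 - θ.2.2.2.2)
  let X : AddCircle β × ℝ × ℝ × Space d × Space d → Ω → ℝ :=
    fun θ ω => θ.2.1 * regField φ hχ θ.1 θ.2.2.2.1 ω + θ.2.2.1 * regField φ hχ θ.1 θ.2.2.2.2 ω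
  have hrv := hφ.measurable_regVar hχ
  have hbm : Measurable b := by fun_prop
  have hX : Measurable fun q : (AddCircle β × ℝ × ℝ × Space d × Space d) × Ω => X q.1 q.2 := by
    have h1 := (hφ.measurable_regField hχ).comp
      (f := fun q : (AddCircle β × ℝ × ℝ × Space d × Space d) × Ω =>
        ((q.1.1, q.1.2.2.2.1), q.2)) (by fun_prop)
    have h2 := (hφ.measurable_regField hχ).comp
      (f := fun q : (AddCircle β × ℝ × ℝ × Space d × Space d) × Ω =>
        ((q.1.1, q.1.2.2.2.2), q.2)) (by fun_prop)
    exact ((by fun_prop : Measurable fun q : (AddCircle β × ℝ × ℝ × Space d × Space d) × Ω =>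
      q.1.2.1).mul h1).add ((by fun_prop : Measurable
        fun q : (AddCircle β × ℝ × ℝ × Space d × Space d) × Ω => q.1.2.2.1).mul h2)
  have hs₁ : SFinite (ρ.prod ((volume : Measure (Space d)).prod (volume : Measure (Space d)))) :=
    inferInstance
  have hs₂ : SFinite (ρ.prod (ρ.prod ((volume : Measure (Space d)).prod
    (volume : Measure (Space d))))) := inferInstance
  refine ⟨AddCircle β × ℝ × ℝ × Space d × Space d, inferInstance,
    volume.prod (ρ.prod (ρ.prod (volume.prod volume))), inferInstance,
    -- The index set `Λ × Λ` is only superadditive in `Λ`: a union also contains the mixed pairs.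
    -- The product of the two exponentials has the single phase `X`.
    w, X, fun Λ => Set.univ ×ˢ (Set.univ ×ˢ (Set.univ ×ˢ (Λ ×ˢ Λ))),
    fun θ => mul_nonneg (by positivity) (hV0 _), hX,
    fun θ => Submodule.add_mem _ (Submodule.smul_mem _ _ (regField_mem_fieldSpace hφ hχ _ _))
      (Submodule.smul_mem _ _ (regField_mem_fieldSpace hφ hχ _ _)), fun Λ hΛ hb => ?_,
    fun Λ₁ Λ₂ => ⟨?_, fun h => ?_⟩⟩
  · have hfin : IsFiniteMeasure (volume.restrict Λ) := ⟨by simpa using hb.measure_lt_top⟩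
    have hres : ((volume : Measure (AddCircle β)).prod (ρ.prod (ρ.prod (volume.prod
        volume)))).restrict (Set.univ ×ˢ (Set.univ ×ˢ (Set.univ ×ˢ (Λ ×ˢ Λ))))
        = volume.prod (ρ.prod (ρ.prod ((volume.restrict Λ).prod (volume.restrict Λ)))) := by
      rw [← Measure.prod_restrict, ← Measure.prod_restrict, ← Measure.prod_restrict,
        ← Measure.prod_restrict, Measure.restrict_univ, Measure.restrict_univ]
    have hwi : Integrable w ((volume : Measure (AddCircle β)).prod (ρ.prod (ρ.prod
        ((volume.restrict Λ).prod (volume.restrict Λ))))) := by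
      obtain ⟨C, hC⟩ := hE.exists_exp_regVar_le hχ hρ
      have hVi := (((integrable_sub_restrict_prod hV hb).comp_snd ρ).comp_snd ρ).comp_snd
        (volume : Measure (AddCircle β))
      refine hVi.bdd_mul (c := lam * C * C) hbm.aestronglyMeasurable ?_
      have a1 := Measure.quasiMeasurePreserving_snd (μ := (volume : Measure (AddCircle β)))
        |>.ae (Measure.quasiMeasurePreserving_fst (ν := ρ.prod ((volume.restrict Λ).prod
          (volume.restrict Λ))) |>.ae hC)
      have a2 := Measure.quasiMeasurePreserving_snd (μ := (volume : Measure (AddCircle β)))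
        |>.ae (Measure.quasiMeasurePreserving_snd (μ := ρ) |>.ae
          (Measure.quasiMeasurePreserving_fst (ν := (volume.restrict Λ).prod
            (volume.restrict Λ)) |>.ae hC))
      filter_upwards [a1, a2] with θ h1 h2
      rw [Real.norm_eq_abs, abs_mul, abs_mul, abs_of_pos hlam]
      have hC0 : 0 ≤ C := (abs_nonneg _).trans (h1 0)
      exact mul_le_mul (mul_le_mul_of_nonneg_left (h1 _) hlam.le) (h2 _) (abs_nonneg _)
        (mul_nonneg hlam.le hC0)
    refine ⟨MeasurableSet.univ.prod (MeasurableSet.univ.prod (MeasurableSet.univ.prod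
      (hΛ.prod hΛ))), ?_, fun ω => ?_⟩
    · rwa [IntegrableOn, hres]
    · have hXω : Measurable fun θ => X θ ω :=
        hX.comp (f := fun θ => (θ, ω)) measurable_prodMk_right
      have hi := integrable_ofReal_mul_exp hwi hXω
      have e : ∫ θ, (w θ : ℂ) * Complex.exp (Complex.I * X θ ω)
          ∂((volume : Measure (AddCircle β)).prod (ρ.prod (ρ.prod
            ((volume.restrict Λ).prod (volume.restrict Λ)))))
          = nonlocalPerturbation z E φ hχ lam ρ V Λ ω := by
        rw [integral_prod_of_section_eq hi (G := fun τ => ∫ α, ∫ α', ∫ x in Λ, ∫ y in Λ,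
          (lam : ℂ) * (wickExp z E φ hχ α τ x ω * (V (x - y) : ℂ) * wickExp z E φ hχ α' τ y ω)
          ∂volume ∂volume ∂ρ ∂ρ), nonlocalPerturbation]
        · simp only [integral_const_mul]
        · refine fun τ h1 => integral_prod_of_section_eq h1 fun α h2 =>
            integral_prod_of_section_eq h2 fun α' h3 =>
            integral_prod_of_section_eq h3 fun x h4 => ?_
          congr 1
          ext y
          simp only [w, X, b, wickExp]
          push_cast
          rw [mul_add, Complex.exp_add]
          ring_nf
      rw [hres, ← integral_eq_ofReal_of_conj_eq hwi hXω, e]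
      rw [e, conj_nonlocalPerturbation]
  · rintro θ (h | h)
    · exact ⟨trivial, trivial, trivial, Or.inl h.2.2.2.1, Or.inl h.2.2.2.2⟩
    · exact ⟨trivial, trivial, trivial, Or.inr h.2.2.2.1, Or.inr h.2.2.2.2⟩
  · simp [Set.prod_inter_prod, Measure.prod_prod, h]

end Perturbation

/-! ### Consequences for cosine families, including supermultiplicativity. -/

section Family

variable {d : ℕ} {Ω : Type*} [MeasurableSpace Ω] {P : Measure Ω} {H : Submodule ℝ (Ω → ℝ)}
  {W : Set (Space d) → Ω → ℂ}

theorem IsCosineFamily.isGinibre (hW : IsCosineFamily H W) (hH : IsGaussianSpace P H)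
    {Λ : Set (Space d)} (hΛ : MeasurableSet Λ) (hb : Bornology.IsBounded Λ) :
    (∀ ω, (W Λ ω).im = 0) ∧ IsGinibre P H (fun ω => (W Λ ω).re) := by
  obtain ⟨Θ, _, ν, _, w, X, T, hw0, hX, hXH, hT, -⟩ := hW
  obtain ⟨-, hwi, hWe⟩ := hT Λ hΛ hb
  simp only [hWe, Complex.ofReal_im, Complex.ofReal_re]
  exact ⟨fun _ => trivial, hH.isGinibre_integral hwi hw0 hX hXH⟩

/-- Use `e^x ≥ 1 + x`; the exponent has nonnegative mean because each Gaussian cosine does. -/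
theorem IsGaussianSpace.one_le_integral_exp (hH : IsGaussianSpace P H) {Θ : Type*}
    [MeasurableSpace Θ] {ν : Measure Θ} [SFinite ν] {w : Θ → ℝ} (hw : Integrable w ν)
    (hw0 : ∀ θ, 0 ≤ w θ) {X : Θ → Ω → ℝ} (hm : Measurable (fun q : Θ × Ω => X q.1 q.2))
    (hX : ∀ θ, X θ ∈ H) :
    1 ≤ ∫ ω, Real.exp (∫ θ, w θ * Real.cos (X θ ω) ∂ν) ∂P := by
  have := hH.isProbabilityMeasure
  have hG := hH.isGinibre_integral hw hw0 hm hX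
  have hi : Integrable (fun ω => ∫ θ, w θ * Real.cos (X θ ω) ∂ν) P := by
    simpa using integrable_bounded_mul hG.measurable hG.bounded (integrable_const (μ := P) (1 : ℝ))
  have hF : Integrable (Function.uncurry fun θ ω => w θ * Real.cos (X θ ω)) (ν.prod P) := by
    have h1 : Integrable (fun q : Θ × Ω => Real.cos (X q.1 q.2) * w q.1) (ν.prod P) :=
      integrable_bounded_mul (Real.measurable_cos.comp hm) ⟨1, fun _ => Real.abs_cos_le_one _⟩
        (hw.comp_fst P)
    exact h1.congr (Filter.Eventually.of_forall fun q => mul_comm _ _)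
  have h0 : 0 ≤ ∫ ω, ∫ θ, w θ * Real.cos (X θ ω) ∂ν ∂P := by
    rw [← integral_integral_swap hF]
    refine integral_nonneg fun θ => ?_
    simp only [integral_const_mul]
    exact mul_nonneg (hw0 θ) (hH.integral_cos_nonneg (hX θ))
  have h1 : ∫ ω, (∫ θ, w θ * Real.cos (X θ ω) ∂ν) + 1 ∂P
      ≤ ∫ ω, Real.exp (∫ θ, w θ * Real.cos (X θ ω) ∂ν) ∂P :=
    integral_mono (hi.add (integrable_const 1)) hG.integrable_exp fun ω => Real.add_one_le_exp _
  rw [integral_add hi (integrable_const 1)] at h1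
  simp only [integral_const, probReal_univ, one_smul] at h1
  linarith

/-- The index set of the union splits into those of `Λ₁` and `Λ₂`, disjoint up to a null set, and a
remainder of cross terms. Two uses of `integral_exp_mul_le` separate the pieces, and the remainder
contributes a factor at least `1`. -/
theorem IsCosineFamily.partitionFunction_mul_le (hW : IsCosineFamily H W)
    (hH : IsGaussianSpace P H) {Λ₁ Λ₂ : Set (Space d)} (h₁ : MeasurableSet Λ₁)
    (b₁ : Bornology.IsBounded Λ₁) (h₂ : MeasurableSet Λ₂) (b₂ : Bornology.IsBounded Λ₂)
    (h0 : volume (Λ₁ ∩ Λ₂) = 0) :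
    partitionFunction P (W Λ₁) * partitionFunction P (W Λ₂)
      ≤ partitionFunction P (W (Λ₁ ∪ Λ₂)) := by
  obtain ⟨Θ, _, ν, _, w, X, T, hw0, hX, hXH, hT, hTT⟩ := hW
  obtain ⟨m1, i1, e1⟩ := hT Λ₁ h₁ b₁
  obtain ⟨m2, i2, e2⟩ := hT Λ₂ h₂ b₂
  obtain ⟨-, i3, e3⟩ := hT _ (h₁.union h₂) (b₁.union b₂)
  obtain ⟨hsub, hnull⟩ := hTT Λ₁ Λ₂
  have hd : AEDisjoint ν (T Λ₁) (T Λ₂) := hnull h0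
  simp only [partitionFunction, e1, e2, e3, Complex.ofReal_re]
  have hcos : ∀ {U : Set Θ}, IntegrableOn w U ν → ∀ ω,
      IntegrableOn (fun θ => w θ * Real.cos (X θ ω)) U ν := fun {U} hU ω =>
    hU.mul_bdd (c := 1)
      (Real.measurable_cos.comp (hX.comp (f := fun θ => (θ, ω))
        measurable_prodMk_right)).aestronglyMeasurable
      (Filter.Eventually.of_forall fun θ => Real.abs_cos_le_one _)
  have hmu := m1.union m2
  have k1 := hH.integral_exp_mul_le (hH.isGinibre_integral i1 hw0 hX hXH)
    (hH.isGinibre_integral i2 hw0 hX hXH)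
  have s1 : ∀ ω, ∫ θ in T Λ₁ ∪ T Λ₂, w θ * Real.cos (X θ ω) ∂ν
      = (∫ θ in T Λ₁, w θ * Real.cos (X θ ω) ∂ν) + ∫ θ in T Λ₂, w θ * Real.cos (X θ ω) ∂ν :=
    fun ω => setIntegral_union₀ hd m2.nullMeasurableSet (hcos i1 ω) (hcos i2 ω)
  simp only [← s1] at k1
  have iu : IntegrableOn w (T Λ₁ ∪ T Λ₂) ν := i3.mono_set hsub
  have ic : IntegrableOn w (T (Λ₁ ∪ Λ₂) \ (T Λ₁ ∪ T Λ₂)) ν := i3.mono_set Set.sdiff_subset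
  have k2 := hH.integral_exp_mul_le (hH.isGinibre_integral iu hw0 hX hXH)
    (hH.isGinibre_integral ic hw0 hX hXH)
  have s2 : ∀ ω, (∫ θ in T Λ₁ ∪ T Λ₂, w θ * Real.cos (X θ ω) ∂ν)
      + ∫ θ in T (Λ₁ ∪ Λ₂) \ (T Λ₁ ∪ T Λ₂), w θ * Real.cos (X θ ω) ∂ν
      = ∫ θ in T (Λ₁ ∪ Λ₂), w θ * Real.cos (X θ ω) ∂ν := fun ω => by
    rw [add_comm, setIntegral_sdiff hmu (hcos i3 ω) hsub, sub_add_cancel]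
  simp only [s2] at k2
  have k3 := hH.one_le_integral_exp ic hw0 hX hXH
  refine k1.trans (le_trans ?_ k2)
  exact le_mul_of_one_le_right (integral_nonneg fun ω => (Real.exp_pos _).le) k3

end Family

theorem isCosineFamily_of_isEvenGentle {d : ℕ} {β z : ℝ} [Fact (0 < β)] {E : Space d → ℝ}
    (hE : Noncritical β z E) {Ω : Type*} [MeasurableSpace Ω] {P : Measure Ω}
    {φ : AddCircle β → RealL2 d → Ω → ℝ} (hφ : IsFreeThermalField β z E P φ)
    {ε : ℝ} {χ : Space d → ℝ} (hχ : IsMollifier ε χ)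
    {ρ : Measure ℝ} [IsFiniteMeasure ρ] [ρ.IsNegInvariant]
    (hρ : ∃ R : ℝ, ρ {α | R < |α|} = 0) {lam : ℝ} (hlam : 0 < lam)
    {W : Set (Space d) → Ω → ℂ} (hW : IsEvenGentle z E φ hχ lam ρ W) :
    IsCosineFamily (fieldSpace hφ) W := by
  obtain rfl | ⟨V, hV, hV0, rfl⟩ := hW
  · exact isCosineFamily_localPerturbation hE hφ hχ hρ hlam
  · exact isCosineFamily_nonlocalPerturbation hE hφ hχ hρ hlam hV hV0

end ThermalBose

/-! ### The correlation inequalities for the thermal field. -/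

theorem proposition3p8 {d : ℕ} {β z : ℝ} [Fact (0 < β)] {E : Space d → ℝ}
    (hE : Noncritical β z E)
    {Ω : Type*} [MeasurableSpace Ω] {P : Measure Ω}
    {φ : AddCircle β → RealL2 d → Ω → ℝ} (hφ : IsFreeThermalField β z E P φ)
    {ε : ℝ} {χ : Space d → ℝ} (hχ : IsMollifier ε χ)
    {ρ : Measure ℝ} [IsFiniteMeasure ρ] [ρ.IsNegInvariant]
    (hρ : ∃ R : ℝ, ρ {α | R < |α|} = 0)
    {lam : ℝ} (hlam : 0 < lam)
    {W : Set (Space d) → Ω → ℂ} (hW : IsEvenGentle z E φ hχ lam ρ W) :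
    -- the interaction is real and the perturbed measure is a well-defined probability measure
    (∀ Λ : Set (Space d), MeasurableSet Λ → Bornology.IsBounded Λ →
      (∀ ω, (W Λ ω).im = 0) ∧ Integrable (fun ω => Real.exp (W Λ ω).re) P ∧
        IsProbabilityMeasure (perturbedMeasure P (W Λ))) ∧
    -- 1. supermultiplicativity of the partition function
    (∀ Λ₁ Λ₂ : Set (Space d), MeasurableSet Λ₁ → Bornology.IsBounded Λ₁ →
      MeasurableSet Λ₂ → Bornology.IsBounded Λ₂ → volume (Λ₁ ∩ Λ₂) = 0 →
      partitionFunction P (W Λ₁) * partitionFunction P (W Λ₂) ≤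
        partitionFunction P (W (Λ₁ ∪ Λ₂))) ∧
    ∀ Λ : Set (Space d), MeasurableSet Λ → Bornology.IsBounded Λ →
      -- 2.
      (∀ (g : AddCircle β → ℝ), MemLp g 2 volume → ∀ (f : RealL2 d) (α : ℝ)
          (τ : AddCircle β) (x : Space d),
        TruncatedExists (perturbedMeasure P (W Λ)) (fun ω => smeared φ g f ω ^ 2)
          (wickCos z E φ hχ α τ x) ∧
        truncated (perturbedMeasure P (W Λ)) (fun ω => smeared φ g f ω ^ 2)
          (wickCos z E φ hχ α τ x) ≤ 0) ∧
      -- 3.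
      (∀ (g : AddCircle β → ℝ), MemLp g 2 volume → ∀ (f : RealL2 d) (t : ℝ)
          (n : ℕ) (α : Fin n → ℝ) (τ : Fin n → AddCircle β) (x : Fin n → Space d),
        TruncatedExists (perturbedMeasure P (W Λ)) (fun ω => Real.exp (t * smeared φ g f ω))
          (fun ω => ∏ i, wickCos z E φ hχ (α i) (τ i) (x i) ω) ∧
        truncated (perturbedMeasure P (W Λ)) (fun ω => Real.exp (t * smeared φ g f ω))
          (fun ω => ∏ i, wickCos z E φ hχ (α i) (τ i) (x i) ω) ≤ 0) ∧
      -- 4.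
      (∀ (g : AddCircle β → ℝ), MemLp g 2 volume → ∀ (f : RealL2 d)
          (n : ℕ) (α : Fin n → ℝ) (τ : Fin n → AddCircle β) (x : Fin n → Space d),
        TruncatedExists (perturbedMeasure P (W Λ))
          (fun ω => Complex.exp (Complex.I * smeared φ g f ω))
          (fun ω => ((∏ i, wickCos z E φ hχ (α i) (τ i) (x i) ω : ℝ) : ℂ)) ∧
        (truncated (perturbedMeasure P (W Λ))
          (fun ω => Complex.exp (Complex.I * smeared φ g f ω))
          (fun ω => ((∏ i, wickCos z E φ hχ (α i) (τ i) (x i) ω : ℝ) : ℂ))).im = 0 ∧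
        0 ≤ (truncated (perturbedMeasure P (W Λ))
          (fun ω => Complex.exp (Complex.I * smeared φ g f ω))
          (fun ω => ((∏ i, wickCos z E φ hχ (α i) (τ i) (x i) ω : ℝ) : ℂ))).re) ∧
      -- 5.
      (∀ (n m : ℕ) (α : Fin n → ℝ) (s : Fin n → AddCircle β) (x : Fin n → Space d)
          (γ : Fin m → ℝ) (t : Fin m → AddCircle β) (y : Fin m → Space d),
        TruncatedExists (perturbedMeasure P (W Λ))
          (fun ω => ∏ i, Real.cos (α i * regField φ hχ (s i) (x i) ω))
          (fun ω => ∏ j, Real.cos (γ j * regField φ hχ (t j) (y j) ω)) ∧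
        0 ≤ truncated (perturbedMeasure P (W Λ))
          (fun ω => ∏ i, Real.cos (α i * regField φ hχ (s i) (x i) ω))
          (fun ω => ∏ j, Real.cos (γ j * regField φ hχ (t j) (y j) ω))) := by
  have hH := isGaussianSpace_fieldSpace hφ
  have hP := hφ.isProbabilityMeasure
  have hC := isCosineFamily_of_isEvenGentle hE hφ hχ hρ hlam hW
  have hcos : ∀ (a : ℝ) (τ : AddCircle β) (x : Space d),
      IsGinibre P (fieldSpace hφ) (fun ω => Real.cos (a * regField φ hχ τ x ω)) := fun a τ x =>
    hH.isGinibre_cos (Submodule.smul_mem _ a (regField_mem_fieldSpace hφ hχ τ x))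
  -- Wick ordering multiplies the cosine by a positive constant independent of `ω`.
  have hwick : ∀ (a : ℝ) (τ : AddCircle β) (x : Space d),
      IsGinibre P (fieldSpace hφ) (wickCos z E φ hχ a τ x) := fun a τ x =>
    (hcos a τ x).const_mul (Real.exp_pos _).le
  refine ⟨fun Λ hΛ hb => ?_, fun Λ₁ Λ₂ h₁ b₁ h₂ b₂ h0 =>
    hC.partitionFunction_mul_le hH h₁ b₁ h₂ b₂ h0, fun Λ hΛ hb => ?_⟩
  · obtain ⟨him, hG⟩ := hC.isGinibre hH hΛ hb
    exact ⟨him, hG.integrable_exp, isProbabilityMeasure_tilted hG.integrable_exp⟩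
  obtain ⟨-, hG⟩ := hC.isGinibre hH hΛ hb
  have hint : ∀ {A : Ω → ℝ}, IsGinibre P (fieldSpace hφ) A → Integrable A P := fun hA => by
    simpa using integrable_bounded_mul hA.measurable hA.bounded (integrable_const (μ := P) (1 : ℝ))
  refine ⟨fun g hg f a τ x => ?_, fun g hg f t n a τ x => ?_, fun g hg f n a τ x => ?_,
    fun n m a s x γ t y => ?_⟩
  · have hY := smeared_mem_fieldSpace hφ hg f
    exact ⟨hG.truncatedExists (hH.memLp hY).integrable_sq (hwick a τ x).measurable
      (hwick a τ x).bounded, hH.truncated_sq_nonpos hG (hwick a τ x) hY⟩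
  · have hY := Submodule.smul_mem _ t (smeared_mem_fieldSpace hφ hg f)
    have hB := hH.isGinibre_prod Finset.univ fun i => hwick (a i) (τ i) (x i)
    exact ⟨hG.truncatedExists (hH.integrable_exp hY) hB.measurable hB.bounded,
      hH.truncated_exp_nonpos hG hB hY⟩
  · have hY := smeared_mem_fieldSpace hφ hg f
    have hB := hH.isGinibre_prod Finset.univ fun i => hwick (a i) (τ i) (x i)
    refine ⟨hG.truncatedExists
      (integrable_exp_I_mul (hH.measurable _ hY).aestronglyMeasurable)
      (Complex.measurable_ofReal.comp hB.measurable) ?_, ?_⟩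
    · obtain ⟨C, hC⟩ := hB.bounded
      exact ⟨C, fun ω => by rw [Complex.norm_real]; exact hC ω⟩
    · have h := hH.truncated_cexp hG hB hY
      rw [perturbedMeasure, h]
      exact ⟨Complex.ofReal_im _, by
        rw [Complex.ofReal_re]
        exact hH.truncated_nonneg_of_isGinibre hG (hH.isGinibre_cos hY) hB⟩
  · have hA := hH.isGinibre_prod Finset.univ fun i => hcos (a i) (s i) (x i)
    have hB := hH.isGinibre_prod Finset.univ fun j => hcos (γ j) (t j) (y j)
    exact ⟨hG.truncatedExists (hint hA) hB.measurable hB.bounded,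
      hH.truncated_nonneg_of_isGinibre hG hA hB⟩
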